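/- For $\alpha>-1$ let $J_\alpha$ be the Bessel function of the first kind of order $\alpha$, let $\phi_\alpha(u)=u^{-\alpha}J_\alpha(u)$ for $u>0$, with $\phi_\alpha(0)=\lim_{u\to0^+}\phi_\alpha(u)$, and put $$\psi_\alpha(u)=\tfrac12\big[\phi_\alpha(|u|)+i\,u\,\phi_{\alpha+1}(|u|)\big],\quad u\in\mathbb R,\qquad dw_\alpha(u)=|u|^{2\alpha+1}\,du .$$ The Hankel–Dunkl heat kernel and, for $\sigma>0$, the Hankel–Dunkl Riesz potential kernel are $$\mathbb W_t^{\alpha}(x,y)=\int_{\mathbb R}e^{-u^2t}\,\psi_\alpha(xu)\,\overline{\psi_\alpha(yu)}\,dw_\alpha(u),\qquad \mathbb K^{\alpha,\sigma}(x,y)=\frac1{\Gamma(\sigma)}\int_0^\infty \mathbb W_t^{\alpha}(x,y)\,t^{\sigma-1}\,dt,\qquad x,y\in\mathbb R,\ t>0 .$$ **Theorem.** Let $\alpha\ge-1/2$ and $0<\sigma<\alpha+1$. Then $\mathbb W_t^{\alpha}(x,y)$ is real and nonnegative for all $x,y\in\mathbb R$, $t>0$ (so that $\mathbb K^{\alpha,\sigma}(x,y)$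 is well defined in $[0,\infty]$), and there is a constant $C>0$ depending only on $\alpha$ and $\sigma$ such that for all $x,y\in\mathbb R$ $$C^{-1}\,B(x,y)\le\mathbb K^{\alpha,\sigma}(x,y)\le C\,B(x,y),\qquad B(x,y)=(|x|+|y|)^{-2\alpha-1}\begin{cases}|x-y|^{2\sigma-1},&\sigma<1/2,\\ \log\dfrac{2(|x|+|y|)}{|x-y|},&\sigma=1/2,\\ (|x|+|y|)^{2\sigma-1},&\sigma>1/2.\end{cases}$$ Both sides take values in $[0,\infty]$, with limiting interpretations where an expression is singular: $B(x,x)=\infty$ for $x\ne0$ if $\sigma\le1/2$, and $B(0,0)=\infty$ for every $\sigma$. -/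

import Mathlib

open MeasureTheory Set

open scoped ENNReal

noncomputable section

namespace HankelDunkl

/-- The Bessel function of the first kind `J_α(u)`, for real order `α > -1` and `u > 0`,
given by its defining series. -/
def besselJ (α u : ℝ) : ℝ :=
  ∑' m : ℕ, (-1) ^ m / ((m.factorial : ℝ) * Real.Gamma (m + α + 1)) * (u / 2) ^ (2 * (m : ℝ) + α)

/-- `φ_α(u) = u^{-α} J_α(u)` for `u > 0`; at `u = 0` the value is the limit as `u → 0⁺`, which is
`1 / (2^α Γ(α+1))` (the constant term of the even power series `u^{-α} J_α(u)`). -/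
def phi (α u : ℝ) : ℝ :=
  if u = 0 then 1 / (2 ^ α * Real.Gamma (α + 1)) else u ^ (-α) * besselJ α u

/-- `ψ_α(u) = (1/2) [φ_α(|u|) + i u φ_{α+1}(|u|)]`, for real `u`. -/
def psi (α u : ℝ) : ℂ :=
  (1 / 2 : ℂ) * ((phi α |u| : ℂ) + Complex.I * (u : ℂ) * (phi (α + 1) |u| : ℂ))

/-- The measure `dw_α(x) = |x|^{2α+1} dx` on the real line. -/
def wMeasure (α : ℝ) : Measure ℝ :=
  volume.withDensity fun x => ENNReal.ofReal (|x| ^ (2 * α + 1))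

/-- The Hankel-Dunkl heat kernel
`𝕎_t^α(x,y) = ∫_ℝ e^{-u²t} ψ_α(xu) conj(ψ_α(yu)) dw_α(u)`. -/
def heatKernel (α t x y : ℝ) : ℂ :=
  ∫ u : ℝ, (Real.exp (-(u ^ 2 * t)) : ℂ) * psi α (x * u) * (starRingEnd ℂ) (psi α (y * u))
    ∂(wMeasure α)

/-- The Hankel-Dunkl Riesz potential kernel
`𝕂^{α,σ}(x,y) = Γ(σ)⁻¹ ∫_0^∞ 𝕎_t^α(x,y) t^{σ-1} dt`, the integral of a nonnegative function
with values in `[0,∞]`. (This reads off the intended integral when `𝕎_t^α(x,y)` is real and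
nonnegative.) -/
def rieszKernel (α σ x y : ℝ) : ℝ≥0∞ :=
  ENNReal.ofReal (1 / Real.Gamma σ) *
    ∫⁻ t in Ioi (0 : ℝ), ENNReal.ofReal ((heatKernel α t x y).re * t ^ (σ - 1))

/-- The comparison function, with values in `[0,∞]`, as the product of `(|x|+|y|)^{-2α-1}` and
`|x-y|^{2σ-1}`, `log (2(|x|+|y|)/|x-y|)`, `(|x|+|y|)^{2σ-1}` according as `σ <, =, > 1/2`.
On the diagonal the singular expressions have their limiting values: `|x-y|^{2σ-1} = ∞` for
`σ < 1/2` (which `ENNReal.rpow` gives), the logarithm is `∞`, and the whole expression is `∞`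
at the origin. -/
def sharpBound (α σ x y : ℝ) : ℝ≥0∞ :=
  if x = 0 ∧ y = 0 then ∞ else
    ENNReal.ofReal (|x| + |y|) ^ (-2 * α - 1) *
      (if σ < 1 / 2 then ENNReal.ofReal |x - y| ^ (2 * σ - 1)
       else if σ = 1 / 2 then
         (if x = y then ∞ else ENNReal.ofReal (Real.log (2 * (|x| + |y|) / |x - y|)))
       else ENNReal.ofReal (|x| + |y|) ^ (2 * σ - 1))

end HankelDunkl

end

open MeasureTheory Set

open scoped ENNReal

noncomputable section

namespace HankelDunkl

/-! Up to a constant, ψ_α(u) is the Dunkl kernel E_α(z) = C_α(z²/4) + (z/2) C_{α+1}(z²/4) at z = iu,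
where C_α is the Bessel–Clifford series `besselClifford`. Integrating the product of two such series
against a Gaussian term by term gives Weber's second exponential integral; the resulting double
series is summed by Chu–Vandermonde (`hasSum_double_series`). Hence the heat kernel is (4t)^{-α-1}
e^{-(x²+y²)/4t} E_α(xy/2t) (`heatKernel_eq_besselClifford`).

Poisson's integral writes E_α(z) as the integral of (1+s)e^{zs} + (1-s)e^{-zs} against a positive
measure ν on [0,1]. The heat kernel is therefore a positive superposition of Gaussians, which
settles reality and nonnegativity. Integrating in t by Tonelli turns each Gaussian into a power:
with β = α+1-σ > 0, the Riesz kernel is a constant times the ν-integral of (1+s)(x²+y²-2xys)^{-β} +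
(1-s)(x²+y²+2xys)^{-β} (`rieszKernel_eq_lintegral`).

For α > -1/2, ν has density proportional to (1-s²)^{α-1/2}. Let p = |x|+|y|. If xy ≥ 0, the first
quadratic is comparable to p²(a+1-s) with a = (|x-y|/p)², so all reduces to the model integral of
(a+r)^{-β} r^{α-1/2} over (0,1). Its size depends on the sign of κ = σ-1/2, which gives the three
cases of the bound. If xy < 0, then a = 1 and the kernel has size p^{-2β}. For α = -1/2, ν is a
point mass at 1 and the kernel is an exact multiple of |x-y|^{2σ-1}. -/

/-! ### Chu–Vandermonde with Gamma functions. -/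

/-- The Chu–Vandermonde identity for binomial coefficients with a real upper entry, written with
Gamma functions. -/
theorem sum_choose_div_Gamma (m : ℕ) : ∀ (n : ℕ) (α : ℝ), -1 < α →
    ∑ k ∈ Finset.range (n + 1),
        (m.choose k : ℝ) / (Real.Gamma (k + α + 1) * ((n - k).factorial : ℝ)) =
      Real.Gamma (m + n + α + 1) /
        (Real.Gamma (m + α + 1) * Real.Gamma (n + α + 1) * (n.factorial : ℝ)) := by
  induction m with
  | zero =>
    intro n α hα
    have h1 : Real.Gamma (α + 1) ≠ 0 := (Real.Gamma_pos_of_pos (by linarith)).ne'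
    have h2 : Real.Gamma (n + α + 1) ≠ 0 :=
      (Real.Gamma_pos_of_pos (by have : (0 : ℝ) ≤ n := n.cast_nonneg; linarith)).ne'
    have h3 : (n.factorial : ℝ) ≠ 0 := by positivity
    rw [Finset.sum_range_succ']
    simp only [Nat.choose_zero_succ, Nat.cast_zero, zero_div, Finset.sum_const_zero, zero_add,
      Nat.choose_zero_right, Nat.cast_one, Nat.sub_zero]
    field_simp
  | succ m ih =>
    intro n α hα
    have hm0 : (0 : ℝ) ≤ m := m.cast_nonneg
    have hn0 : (0 : ℝ) ≤ n := n.cast_nonneg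
    have h1 : Real.Gamma (m + α + 1) ≠ 0 := (Real.Gamma_pos_of_pos (by linarith)).ne'
    have h2 : Real.Gamma (n + α + 1) ≠ 0 := (Real.Gamma_pos_of_pos (by linarith)).ne'
    have e1 : Real.Gamma ((m + 1 : ℕ) + α + 1) = (m + α + 1) * Real.Gamma (m + α + 1) := by
      rw [← Real.Gamma_add_one (by linarith)]; push_cast; ring_nf
    have e2 : Real.Gamma ((m + 1 : ℕ) + n + α + 1) =
        (m + n + α + 1) * Real.Gamma (m + n + α + 1) := by
      rw [← Real.Gamma_add_one (by linarith)]; push_cast; ring_nf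
    have hma : (m + α + 1 : ℝ) ≠ 0 := by linarith
    -- Pascal's rule: after a shift of `k` the second sum is the one for `(n - 1, α + 1)`, which is
    -- why the induction on `m` keeps `n` and `α` free.
    have split : ∑ k ∈ Finset.range (n + 1),
          ((m + 1).choose k : ℝ) / (Real.Gamma (k + α + 1) * ((n - k).factorial : ℝ)) =
        ∑ k ∈ Finset.range (n + 1),
          (m.choose k : ℝ) / (Real.Gamma (k + α + 1) * ((n - k).factorial : ℝ)) +
        ∑ k ∈ Finset.range n,
          (m.choose k : ℝ) / (Real.Gamma (k + (α + 1) + 1) * ((n - 1 - k).factorial : ℝ)) := by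
      rw [Finset.sum_range_succ', Finset.sum_range_succ' (n := n), add_right_comm (Finset.sum _ _),
        ← Finset.sum_add_distrib]
      congr 1
      · refine Finset.sum_congr rfl fun k _ => ?_
        rw [Nat.choose_succ_succ', show n - 1 - k = n - (k + 1) by omega,
          show ((k + 1 : ℕ) : ℝ) + α + 1 = k + (α + 1) + 1 by push_cast; ring]
        push_cast
        ring
      · simp
    rw [split, ih n α hα, e1, e2]
    rcases n with _ | n
    · simp only [Finset.range_zero, Finset.sum_empty, Nat.cast_zero, add_zero, zero_add] at *
      field_simp
    · have ih' := ih n (α + 1) (by linarith)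
      rw [Nat.add_sub_cancel, ih']
      have e3 : (m + n + (α + 1) + 1 : ℝ) = m + (n + 1 : ℕ) + α + 1 := by push_cast; ring
      have e4 : Real.Gamma (m + (α + 1) + 1) = (m + α + 1) * Real.Gamma (m + α + 1) := by
        rw [← Real.Gamma_add_one (by linarith)]; ring_nf
      have e5 : Real.Gamma (n + (α + 1) + 1) = Real.Gamma ((n + 1 : ℕ) + α + 1) := by
        push_cast; ring_nf
      have h4 : (n.factorial : ℝ) ≠ 0 := by positivity
      have h5 : (n + 1 : ℝ) ≠ 0 := by positivity
      rw [e3, e4, e5, Nat.factorial_succ]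
      push_cast at h2 ⊢
      field_simp
      ring

/-! ### The Bessel–Clifford function and Weber's integral. -/

/-- The Bessel–Clifford function `∑ zᵏ / (k! Γ(k + α + 1))`. -/
def besselClifford (α : ℝ) (z : ℂ) : ℂ :=
  ∑' k : ℕ, z ^ k / ((k.factorial : ℂ) * (Real.Gamma (k + α + 1) : ℂ))

theorem Gamma_pos {α : ℝ} (hα : -1 < α) (k : ℕ) : 0 < Real.Gamma (k + α + 1) :=
  Real.Gamma_pos_of_pos (by have : (0 : ℝ) ≤ k := k.cast_nonneg; linarith)

/-- From `α + 2 > 1` on, each integer step multiplies Gamma by a factor above 1, so the values do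
not decrease. Only `k = 0`, where `α + 1` may be small, is treated apart. The bound reduces
convergence of the series to that of exp. -/
theorem exists_inv_Gamma_le {α : ℝ} (hα : -1 < α) :
    ∃ C : ℝ, 0 < C ∧ ∀ k : ℕ, (Real.Gamma (k + α + 1))⁻¹ ≤ C := by
  refine ⟨(Real.Gamma (α + 1))⁻¹ + (Real.Gamma (α + 2))⁻¹, ?_, ?_⟩
  · have h1 := Real.Gamma_pos_of_pos (show 0 < α + 1 by linarith)
    have h2 := Real.Gamma_pos_of_pos (show 0 < α + 2 by linarith)
    positivity
  · have h1 := Real.Gamma_pos_of_pos (show 0 < α + 1 by linarith)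
    have h2 := Real.Gamma_pos_of_pos (show 0 < α + 2 by linarith)
    have key : ∀ k : ℕ, Real.Gamma (α + 2) ≤ Real.Gamma ((k + 1 : ℕ) + α + 1) := by
      intro k
      induction k with
      | zero => apply le_of_eq; congr 1; push_cast; ring
      | succ k ih =>
        have h3 : (0 : ℝ) ≤ k := k.cast_nonneg
        have h4 : Real.Gamma ((k + 1 + 1 : ℕ) + α + 1) =
            (k + α + 2) * Real.Gamma ((k + 1 : ℕ) + α + 1) := by
          have := Real.Gamma_add_one (s := (k + 1 : ℕ) + α + 1) (by push_cast; linarith)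
          push_cast at this ⊢
          rw [show (k + 1 + 1 + α + 1 : ℝ) = k + 1 + α + 1 + 1 by ring, this]
          ring
        rw [h4]
        nlinarith
    intro k
    rcases k with _ | k
    · simp; positivity
    · have := inv_anti₀ h2 (key k)
      have : 0 < (Real.Gamma (α + 1))⁻¹ := by positivity
      linarith

theorem summable_norm_besselClifford {α : ℝ} (hα : -1 < α) (z : ℂ) :
    Summable fun k : ℕ => ‖z ^ k / ((k.factorial : ℂ) * (Real.Gamma (k + α + 1) : ℂ))‖ := by
  obtain ⟨C, hC, h⟩ := exists_inv_Gamma_le hα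
  refine Summable.of_nonneg_of_le (fun _ => norm_nonneg _) (fun k => ?_)
    ((Real.summable_pow_div_factorial ‖z‖).mul_right C)
  rw [norm_div, norm_mul, norm_pow, Complex.norm_natCast, Complex.norm_real,
    Real.norm_of_nonneg (Gamma_pos hα k).le, ← div_div, div_eq_mul_inv _ (Real.Gamma _)]
  gcongr
  exact h k

theorem hasSum_besselClifford {α : ℝ} (hα : -1 < α) (z : ℂ) :
    HasSum (fun k : ℕ => z ^ k / ((k.factorial : ℂ) * (Real.Gamma (k + α + 1) : ℂ)))
      (besselClifford α z) :=
  (summable_norm_besselClifford hα z).of_norm.hasSum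

theorem hasSum_exp (z : ℂ) : HasSum (fun n : ℕ => z ^ n / (n.factorial : ℂ)) (Complex.exp z) := by
  have := NormedSpace.expSeries_div_hasSum_exp (𝔸 := ℂ) z
  rwa [← Complex.exp_eq_exp_ℂ] at this

theorem summable_norm_exp (z : ℂ) : Summable fun n : ℕ => ‖z ^ n / (n.factorial : ℂ)‖ := by
  simpa using NormedSpace.norm_expSeries_div_summable (𝔸 := ℂ) z

/-- The sum is the coefficient of `a ^ m * b ^ n` in exp(a) exp(b) C_α(ab). Terms of Chu–Vandermonde
with `k > m` vanish with the binomial, so the range stops at the minimum. -/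
theorem sum_vandermonde_min {α : ℝ} (hα : -1 < α) (m n : ℕ) :
    ∑ k ∈ Finset.range (min m n + 1), (1 : ℝ) / ((m - k).factorial * (n - k).factorial *
        (k.factorial * Real.Gamma (k + α + 1))) =
      Real.Gamma (m + n + α + 1) /
        (m.factorial * n.factorial * (Real.Gamma (m + α + 1) * Real.Gamma (n + α + 1))) := by
  have h := sum_choose_div_Gamma m n α hα
  have hsub : Finset.range (min m n + 1) ⊆ Finset.range (n + 1) := by
    intro k hk; simp only [Finset.mem_range] at hk ⊢; omega
  rw [← Finset.sum_subset hsub] at h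
  · have hm : (m.factorial : ℝ) ≠ 0 := by positivity
    rw [show Real.Gamma (m + n + α + 1) /
        (m.factorial * n.factorial * (Real.Gamma (m + α + 1) * Real.Gamma (n + α + 1))) =
        (1 / m.factorial) * (Real.Gamma (m + n + α + 1) /
        (Real.Gamma (m + α + 1) * Real.Gamma (n + α + 1) * n.factorial)) by
          rw [one_div, ← div_eq_inv_mul, div_div]; congr 1; ring, ← h, Finset.mul_sum]
    refine Finset.sum_congr rfl fun k hk => ?_
    have hk' : k ≤ m := by simp only [Finset.mem_range] at hk; omega
    rw [Nat.cast_choose ℝ hk']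
    have := (Gamma_pos hα k).ne'
    field_simp
  · intro k hk hk'
    simp only [Finset.mem_range] at hk hk'
    rw [Nat.choose_eq_zero_of_lt (by omega)]
    simp

theorem hasSum_double_series {α : ℝ} (hα : -1 < α) (a b : ℂ) :
    HasSum (fun p : ℕ × ℕ => a ^ p.1 * b ^ p.2 * ((Real.Gamma (p.1 + p.2 + α + 1) /
        (p.1.factorial * p.2.factorial *
          (Real.Gamma (p.1 + α + 1) * Real.Gamma (p.2 + α + 1))) : ℝ) : ℂ))
      (Complex.exp (a + b) * besselClifford α (a * b)) := by
  obtain ⟨u, hu⟩ : ∃ u : ℕ → ℂ, u = fun n => a ^ n / (n.factorial : ℂ) := ⟨_, rfl⟩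
  obtain ⟨v, hv⟩ : ∃ v : ℕ → ℂ, v = fun n => b ^ n / (n.factorial : ℂ) := ⟨_, rfl⟩
  obtain ⟨w, hw⟩ : ∃ w : ℕ → ℂ, w = fun k : ℕ =>
    (a * b) ^ k / ((k.factorial : ℂ) * (Real.Gamma (k + α + 1) : ℂ)) := ⟨_, rfl⟩
  have su : Summable fun n => ‖u n‖ := hu ▸ summable_norm_exp a
  have sv : Summable fun n => ‖v n‖ := hv ▸ summable_norm_exp b
  have sw : Summable fun n => ‖w n‖ := hw ▸ summable_norm_besselClifford hα (a * b)
  have hu' : HasSum u (Complex.exp a) := hu ▸ hasSum_exp a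
  have hv' : HasSum v (Complex.exp b) := hv ▸ hasSum_exp b
  have hw' : HasSum w (besselClifford α (a * b)) := hw ▸ hasSum_besselClifford hα (a * b)
  have hfs : HasSum (fun q : (ℕ × ℕ) × ℕ => u q.1.1 * v q.1.2 * w q.2)
      (Complex.exp (a + b) * besselClifford α (a * b)) := by
    rw [Complex.exp_add]
    have huv : HasSum (fun p : ℕ × ℕ => u p.1 * v p.2) (Complex.exp a * Complex.exp b) :=
      HasSum.mul hu' hv' (summable_mul_of_summable_norm su sv)
    have suv : Summable fun p : ℕ × ℕ => ‖u p.1 * v p.2‖ := su.mul_norm sv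
    have sall := summable_mul_of_summable_norm suv sw
    exact HasSum.mul (f := fun p : ℕ × ℕ => u p.1 * v p.2) (g := w) huv hw' sall
  -- The term (i, j, k) of the triple product series carries the monomial a^{i+k} b^{j+k}. This
  -- injection sorts terms by monomial, and `g` is the extension by zero, so that summing over the
  -- fibres collects coefficients.
  set ι : (ℕ × ℕ) × ℕ → (ℕ × ℕ) × ℕ := fun q => ((q.1.1 + q.2, q.1.2 + q.2), q.2) with hι
  have hinj : Function.Injective ι := by
    rintro ⟨⟨i, j⟩, k⟩ ⟨⟨i', j'⟩, k'⟩ h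
    simp only [hι, Prod.mk.injEq] at h ⊢
    omega
  set g : (ℕ × ℕ) × ℕ → ℂ := fun q => if q.2 ≤ q.1.1 ∧ q.2 ≤ q.1.2 then
    a ^ q.1.1 * b ^ q.1.2 * ((1 / ((q.1.1 - q.2).factorial * (q.1.2 - q.2).factorial *
        (q.2.factorial * Real.Gamma (q.2 + α + 1))) : ℝ) : ℂ) else 0 with hg
  have hgf : g ∘ ι = fun q => u q.1.1 * v q.1.2 * w q.2 := by
    funext ⟨⟨i, j⟩, k⟩
    simp only [hg, hι, hu, hv, hw, Function.comp, le_add_iff_nonneg_left, zero_le, and_self, if_true,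
      Nat.add_sub_cancel]
    push_cast
    rw [pow_add, pow_add, mul_pow]
    ring
  have hgs : HasSum g (Complex.exp (a + b) * besselClifford α (a * b)) := by
    rw [← hinj.hasSum_iff, hgf]
    · exact hfs
    · rintro ⟨⟨m, n⟩, k⟩ hq
      simp only [hg]
      rw [if_neg]
      rintro ⟨h1, h2⟩
      apply hq
      exact ⟨((m - k, n - k), k), by
        simp only [hι, Nat.sub_add_cancel h1, Nat.sub_add_cancel h2]⟩
  refine hgs.prod_fiberwise fun p => ?_
  obtain ⟨m, n⟩ := p
  rw [← sum_vandermonde_min hα, Complex.ofReal_sum, Finset.mul_sum]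
  have hzero : ∀ k ∉ Finset.range (min m n + 1), g ((m, n), k) = 0 := by
    intro k hk
    simp only [Finset.mem_range] at hk
    exact if_neg (fun h : k ≤ m ∧ k ≤ n => hk (by omega))
  have hs : HasSum (fun k => g ((m, n), k)) (∑ k ∈ Finset.range (min m n + 1), g ((m, n), k)) :=
    hasSum_sum_of_ne_finset_zero hzero
  convert hs using 1
  refine Finset.sum_congr rfl fun k hk => ?_
  simp only [Finset.mem_range] at hk
  exact (if_pos (show k ≤ m ∧ k ≤ n by omega)).symm

theorem integral_rpow_mul_gaussian {q t : ℝ} (hq : 0 < q) (ht : 0 < t) :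
    ∫ u in Ioi (0 : ℝ), u ^ (2 * q - 1) * Real.exp (-t * u ^ (2 : ℝ)) =
      1 / 2 * t ^ (-q) * Real.Gamma q := by
  rw [integral_rpow_mul_exp_neg_mul_rpow (by norm_num) (by linarith) ht]
  rw [show -(2 * q - 1 + 1) / 2 = -q by ring, show (2 * q - 1 + 1) / 2 = q by ring]
  ring

theorem integrableOn_rpow_mul_gaussian {q t : ℝ} (hq : 0 < q) (ht : 0 < t) :
    IntegrableOn (fun u : ℝ => u ^ (2 * q - 1) * Real.exp (-t * u ^ (2 : ℝ))) (Ioi 0) :=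
  integrableOn_rpow_mul_exp_neg_mul_rpow (by linarith) (by norm_num) ht

theorem hasSum_besselClifford_mul {α : ℝ} (hα : -1 < α) (a b : ℂ) :
    HasSum (fun p : ℕ × ℕ => a ^ p.1 * b ^ p.2 * ((1 / (p.1.factorial * p.2.factorial *
        (Real.Gamma (p.1 + α + 1) * Real.Gamma (p.2 + α + 1))) : ℝ) : ℂ))
      (besselClifford α a * besselClifford α b) := by
  obtain ⟨u, hu⟩ : ∃ u : ℕ → ℂ, u = fun k : ℕ =>
    a ^ k / ((k.factorial : ℂ) * (Real.Gamma (k + α + 1) : ℂ)) := ⟨_, rfl⟩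
  obtain ⟨v, hv⟩ : ∃ v : ℕ → ℂ, v = fun k : ℕ =>
    b ^ k / ((k.factorial : ℂ) * (Real.Gamma (k + α + 1) : ℂ)) := ⟨_, rfl⟩
  have su : Summable fun n => ‖u n‖ := hu ▸ summable_norm_besselClifford hα a
  have sv : Summable fun n => ‖v n‖ := hv ▸ summable_norm_besselClifford hα b
  have hu' : HasSum u (besselClifford α a) := hu ▸ hasSum_besselClifford hα a
  have hv' : HasSum v (besselClifford α b) := hv ▸ hasSum_besselClifford hα b
  refine (HasSum.mul hu' hv' (summable_mul_of_summable_norm su sv)).congr_fun fun p => ?_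
  simp only [hu, hv]
  push_cast
  ring

/-- Weber's second exponential integral, for the Bessel–Clifford function. -/
theorem integral_gaussian_mul_besselClifford {α t : ℝ} (hα : -1 < α) (ht : 0 < t) (a b : ℂ) :
    ∫ u in Ioi (0 : ℝ), ((u ^ (2 * α + 1) * Real.exp (-t * u ^ (2 : ℝ)) : ℝ) : ℂ) *
        (besselClifford α (a * (u : ℂ) ^ 2) * besselClifford α (b * (u : ℂ) ^ 2)) =
      ((1 / 2 * t ^ (-(α + 1)) : ℝ) : ℂ) *
        (Complex.exp (a / t + b / t) * besselClifford α (a / t * (b / t))) := by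
  set c : ℕ × ℕ → ℂ := fun p => a ^ p.1 * b ^ p.2 * ((1 / (p.1.factorial * p.2.factorial *
        (Real.Gamma (p.1 + α + 1) * Real.Gamma (p.2 + α + 1))) : ℝ) : ℂ) with hc
  set q : ℕ × ℕ → ℝ := fun p => p.1 + p.2 + α + 1 with hq
  have hq0 : ∀ p, 0 < q p := fun p => by
    have h1 : (0 : ℝ) ≤ p.1 := p.1.cast_nonneg
    have h2 : (0 : ℝ) ≤ p.2 := p.2.cast_nonneg
    simp only [hq]; linarith
  set F : ℕ × ℕ → ℝ → ℂ := fun p u =>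
    ((u ^ (2 * q p - 1) * Real.exp (-t * u ^ (2 : ℝ)) : ℝ) : ℂ) * c p with hF
  have hint : ∀ p, ∫ u in Ioi (0 : ℝ), F p u =
      ((1 / 2 * t ^ (-q p) * Real.Gamma (q p) : ℝ) : ℂ) * c p := fun p => by
    simp only [hF]
    rw [integral_mul_const, integral_complex_ofReal, integral_rpow_mul_gaussian (hq0 p) ht]
  have hintn : ∀ p, ∫ u in Ioi (0 : ℝ), ‖F p u‖ =
      (1 / 2 * t ^ (-q p) * Real.Gamma (q p)) * ‖c p‖ := fun p => by
    rw [← integral_rpow_mul_gaussian (hq0 p) ht, ← integral_mul_const]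
    refine setIntegral_congr_fun measurableSet_Ioi fun u hu => ?_
    have hu' : (0 : ℝ) < u := hu
    simp only [hF]
    rw [norm_mul, Complex.norm_real, Real.norm_of_nonneg (by positivity)]
  -- The Gaussian moment supplies the Gamma value in the numerator of the double series.
  have hterm : ∀ p, ((1 / 2 * t ^ (-q p) * Real.Gamma (q p) : ℝ) : ℂ) * c p =
      ((1 / 2 * t ^ (-(α + 1)) : ℝ) : ℂ) * ((a / t) ^ p.1 * (b / t) ^ p.2 *
        ((Real.Gamma (p.1 + p.2 + α + 1) / (p.1.factorial * p.2.factorial *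
          (Real.Gamma (p.1 + α + 1) * Real.Gamma (p.2 + α + 1))) : ℝ) : ℂ)) := fun p => by
    have e : t ^ (-q p) = t ^ (-(α + 1)) * (t⁻¹ ^ p.1 * t⁻¹ ^ p.2) := by
      rw [← pow_add, show -q p = -(α + 1) + -((p.1 + p.2 : ℕ) : ℝ) by
        simp only [hq]; push_cast; ring, Real.rpow_add ht, Real.rpow_neg ht.le, Real.rpow_neg ht.le,
        Real.rpow_natCast, inv_pow]
    rw [e]
    simp only [hc, hq, div_eq_mul_inv, mul_pow]
    push_cast
    ring
  have hS := (hasSum_double_series hα (a / t) (b / t)).mul_left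
    ((1 / 2 * t ^ (-(α + 1)) : ℝ) : ℂ)
  simp only [← hterm] at hS
  -- Each `F p` is a nonnegative function times a constant, so the integral of its norm is the norm
  -- of its integral, and the absolute convergence of the double series `hS` justifies the exchange.
  have hsum := hasSum_integral_of_summable_integral_norm (μ := volume.restrict (Ioi (0 : ℝ)))
    (F := F) (fun p => ((integrableOn_rpow_mul_gaussian (hq0 p) ht).ofReal).mul_const _) (by
      simp only [hintn]
      refine hS.summable.norm.congr fun p => ?_
      have := Real.Gamma_pos_of_pos (hq0 p)
      rw [norm_mul, Complex.norm_real, Real.norm_of_nonneg (by positivity)])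
  simp only [hint] at hsum
  rw [← hsum.unique hS]
  refine setIntegral_congr_fun measurableSet_Ioi fun u hu => ?_
  have hu' : (0 : ℝ) < u := hu
  have h2 := (hasSum_besselClifford_mul hα (a * (u : ℂ) ^ 2) (b * (u : ℂ) ^ 2)).mul_left
    ((u ^ (2 * α + 1) * Real.exp (-t * u ^ (2 : ℝ)) : ℝ) : ℂ)
  refine Eq.trans h2.tsum_eq.symm (tsum_congr fun p => ?_)
  have e : u ^ (2 * q p - 1) = u ^ (2 * α + 1) * (u ^ (2 * p.1) * u ^ (2 * p.2)) := by
    rw [← pow_add, ← Real.rpow_natCast, ← Real.rpow_add hu']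
    simp only [hq]; push_cast; ring_nf
  simp only [hF, e, hc, mul_pow, ← pow_mul]
  push_cast
  ring

theorem measurable_besselClifford {α : ℝ} (hα : -1 < α) : Measurable (besselClifford α) := by
  refine measurable_of_tendsto_metrizable
    (f := fun n z => ∑ k ∈ Finset.range n, z ^ k /
      ((k.factorial : ℂ) * (Real.Gamma (k + α + 1) : ℂ))) (fun n => ?_)
    (tendsto_pi_nhds.mpr fun z => (hasSum_besselClifford hα z).tendsto_sum_nat)
  fun_prop

/-! ### The functions φ and ψ in terms of Bessel–Clifford functions. -/

theorem besselClifford_ofReal_eq (α x : ℝ) :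
    besselClifford α (x : ℂ) =
      ((∑' k : ℕ, x ^ k / ((k.factorial : ℝ) * Real.Gamma (k + α + 1)) : ℝ) : ℂ) := by
  rw [besselClifford, Complex.ofReal_tsum]
  push_cast
  rfl

/-- The factor `|u| ^ (-α)` cancels the branch point of the Bessel function and leaves an even power
series, whose constant term is the value prescribed at 0. -/
theorem phi_abs_eq (α u : ℝ) :
    (phi α |u| : ℂ) = ((2 ^ (-α) : ℝ) : ℂ) * besselClifford α (-((u : ℂ) ^ 2) / 4) := by
  rw [show -((u : ℂ) ^ 2) / 4 = ((-(u ^ 2) / 4 : ℝ) : ℂ) by push_cast; ring,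
    besselClifford_ofReal_eq, ← Complex.ofReal_mul]
  congr 1
  unfold phi
  split_ifs with h
  · rw [abs_eq_zero] at h
    subst h
    rw [tsum_eq_single 0 (fun k hk => by simp [hk])]
    simp [Real.rpow_neg, mul_comm]
  · have hu : 0 < |u| := lt_of_le_of_ne (abs_nonneg u) (Ne.symm h)
    rw [besselJ, ← tsum_mul_left, ← tsum_mul_left]
    refine tsum_congr fun k => ?_
    have e : (|u| / 2) ^ (2 * (k : ℝ) + α) = (u ^ 2 / 4) ^ k * (|u| ^ α * 2 ^ (-α)) := by
      rw [Real.rpow_add (by positivity), show 2 * (k : ℝ) = ((2 * k : ℕ) : ℝ) by push_cast; ring,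
        Real.rpow_natCast, pow_mul, div_pow, sq_abs, Real.div_rpow hu.le (by norm_num),
        Real.rpow_neg (by norm_num), div_eq_mul_inv (|u| ^ α)]
      norm_num
    rw [e, Real.rpow_neg hu.le]
    have h1 : |u| ^ α ≠ 0 := (Real.rpow_pos_of_pos hu α).ne'
    rw [show -(u ^ 2) / 4 = (-1) * (u ^ 2 / 4) by ring, mul_pow]
    field_simp

theorem psi_eq (α u : ℝ) :
    psi α u = ((2 ^ (-α - 1) : ℝ) : ℂ) * (besselClifford α (-((u : ℂ) ^ 2) / 4) +
      Complex.I * u / 2 * besselClifford (α + 1) (-((u : ℂ) ^ 2) / 4)) := by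
  have h1 : (2 : ℝ) ^ (-α) = 2 * 2 ^ (-α - 1) := by
    rw [Real.rpow_sub_one (by norm_num)]; ring
  rw [psi, phi_abs_eq, phi_abs_eq, show -(α + 1) = -α - 1 by ring, h1]
  push_cast
  ring

/-! ### Poisson's integral, from the even moments alone. -/

/-- A finite measure on `[0, 1]` whose even moments are those of the measure in Poisson's integral
for the Bessel function of order `α`. -/
structure IsPoissonMeasure (α : ℝ) (ν : Measure ℝ) : Prop where
  finite : IsFiniteMeasure ν
  ae_mem : ∀ᵐ s ∂ν, s ∈ Icc (0 : ℝ) 1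
  moment : ∀ k : ℕ, ∫ s, s ^ (2 * k) ∂ν =
    ((2 * k).factorial : ℝ) / (2 * 4 ^ k * (k.factorial * Real.Gamma (k + α + 1)))

namespace IsPoissonMeasure

variable {α : ℝ} {ν : Measure ℝ}

theorem integrable_of_bound (h : IsPoissonMeasure α ν) {E : Type*} [NormedAddCommGroup E]
    {f : ℝ → E} (hf : AEStronglyMeasurable f ν) {C : ℝ}
    (hC : ∀ s ∈ Icc (0 : ℝ) 1, ‖f s‖ ≤ C) : Integrable f ν :=
  have := h.finite
  Integrable.of_bound hf C (h.ae_mem.mono hC)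

theorem integrable_continuous (h : IsPoissonMeasure α ν) {E : Type*} [NormedAddCommGroup E]
    [SecondCountableTopologyEither ℝ E] {f : ℝ → E} (hf : Continuous f) : Integrable f ν := by
  obtain ⟨C, hC⟩ := isCompact_Icc.exists_bound_of_continuousOn (s := Icc (0 : ℝ) 1) hf.continuousOn
  exact h.integrable_of_bound hf.aestronglyMeasurable hC

theorem integral_cosh (h : IsPoissonMeasure α ν) (hα : -1 < α) (z : ℂ) :
    ∫ s : ℝ, Complex.cosh (z * s) ∂ν = 1 / 2 * besselClifford α (z ^ 2 / 4) := by
  have hF : ∀ (k : ℕ) (s : ℝ), (z * s) ^ (2 * k) / ((2 * k).factorial : ℂ) =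
      z ^ (2 * k) / ((2 * k).factorial : ℂ) * ((s ^ (2 * k) : ℝ) : ℂ) := fun k s => by
    push_cast; ring
  have hterm : ∀ k : ℕ, z ^ (2 * k) / ((2 * k).factorial : ℂ) *
      ((∫ s, s ^ (2 * k) ∂ν : ℝ) : ℂ) = 1 / 2 * ((z ^ 2 / 4) ^ k /
        ((k.factorial : ℂ) * (Real.Gamma (k + α + 1) : ℂ))) := fun k => by
    have h1 : ((2 * k).factorial : ℂ) ≠ 0 := by exact_mod_cast (Nat.factorial_pos _).ne'
    rw [h.moment]
    push_cast
    rw [pow_mul, div_pow]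
    field_simp
  have hint : ∀ k : ℕ, Integrable (fun s : ℝ => (z * s) ^ (2 * k) / ((2 * k).factorial : ℂ)) ν :=
    fun k => h.integrable_continuous (by fun_prop)
  have hS := (hasSum_besselClifford hα (z ^ 2 / 4)).mul_left (1 / 2)
  have hsum := hasSum_integral_of_summable_integral_norm hint (by
    refine hS.summable.norm.congr fun k => ?_
    rw [← hterm, norm_mul, Complex.norm_real,
      Real.norm_of_nonneg (integral_nonneg fun s => by
        rw [pow_mul]; positivity), ← integral_const_mul]
    refine integral_congr_ae (Filter.Eventually.of_forall fun s => ?_)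
    simp only [hF]
    rw [norm_mul, Complex.norm_real, Real.norm_of_nonneg (by rw [pow_mul]; positivity)])
  simp only [hF, integral_const_mul, integral_complex_ofReal, hterm] at hsum
  rw [← hsum.unique hS]
  refine integral_congr_ae (Filter.Eventually.of_forall fun s => ?_)
  exact ((Complex.hasSum_cosh (z * s)).tsum_eq.symm).trans (tsum_congr fun k => hF k s)

/-- The extra factor `s` makes all powers even again and shifts the moment index by one, which
raises the order from `α` to `α + 1`. -/
theorem integral_mul_sinh (h : IsPoissonMeasure α ν) (hα : -1 < α) (z : ℂ) :
    ∫ s : ℝ, s * Complex.sinh (z * s) ∂ν =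
      1 / 2 * (z / 2 * besselClifford (α + 1) (z ^ 2 / 4)) := by
  have hF : ∀ (k : ℕ) (s : ℝ), s * ((z * s) ^ (2 * k + 1) / ((2 * k + 1).factorial : ℂ)) =
      z ^ (2 * k + 1) / ((2 * k + 1).factorial : ℂ) * ((s ^ (2 * (k + 1)) : ℝ) : ℂ) :=
    fun k s => by push_cast; ring
  have hterm : ∀ k : ℕ, z ^ (2 * k + 1) / ((2 * k + 1).factorial : ℂ) *
      ((∫ s, s ^ (2 * (k + 1)) ∂ν : ℝ) : ℂ) = 1 / 2 * (z / 2 * ((z ^ 2 / 4) ^ k /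
        ((k.factorial : ℂ) * (Real.Gamma (k + (α + 1) + 1) : ℂ)))) := fun k => by
    have h1 : ((2 * k + 1).factorial : ℂ) ≠ 0 := by exact_mod_cast (Nat.factorial_pos _).ne'
    have h2 : (k + 1 : ℂ) ≠ 0 := by exact_mod_cast Nat.succ_ne_zero k
    rw [h.moment, show ((k + 1 : ℕ) : ℝ) + α + 1 = k + (α + 1) + 1 by push_cast; ring,
      show 2 * (k + 1) = (2 * k + 1) + 1 by ring, Nat.factorial_succ (2 * k + 1),
      Nat.factorial_succ k]
    push_cast
    rw [pow_succ z, pow_mul, div_pow, pow_succ (4 : ℂ)]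
    field_simp
    ring
  have hint : ∀ k : ℕ, Integrable
      (fun s : ℝ => s * ((z * s) ^ (2 * k + 1) / ((2 * k + 1).factorial : ℂ))) ν :=
    fun k => h.integrable_continuous (by fun_prop)
  have hS := ((hasSum_besselClifford (α := α + 1) (by linarith) (z ^ 2 / 4)).mul_left
    (z / 2)).mul_left (1 / 2)
  have hsum := hasSum_integral_of_summable_integral_norm hint (by
    refine hS.summable.norm.congr fun k => ?_
    rw [← hterm, norm_mul, Complex.norm_real, Real.norm_of_nonneg
      (integral_nonneg fun s => (by rw [pow_mul]; positivity)), ← integral_const_mul]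
    refine integral_congr_ae (Filter.Eventually.of_forall fun s => ?_)
    simp only [hF]
    rw [norm_mul, Complex.norm_real, Real.norm_of_nonneg (by rw [pow_mul]; positivity)])
  simp only [hF, integral_const_mul, integral_complex_ofReal, hterm] at hsum
  rw [← hsum.unique hS]
  refine integral_congr_ae (Filter.Eventually.of_forall fun s => ?_)
  exact (((Complex.hasSum_sinh (z * s)).mul_left (s : ℂ)).tsum_eq.symm).trans
    (tsum_congr fun k => hF k s)

/-- Poisson's integral for the Dunkl kernel. -/
theorem integral_dunkl (h : IsPoissonMeasure α ν) (hα : -1 < α) (z : ℂ) :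
    ∫ s : ℝ, (Complex.exp (z * s) * (1 + s) + Complex.exp (-(z * s)) * (1 - s)) ∂ν =
      besselClifford α (z ^ 2 / 4) + z / 2 * besselClifford (α + 1) (z ^ 2 / 4) := by
  have e : ∀ s : ℝ, Complex.exp (z * s) * (1 + s) + Complex.exp (-(z * s)) * (1 - s) =
      2 * (Complex.cosh (z * s) + s * Complex.sinh (z * s)) := fun s => by
    rw [Complex.cosh, Complex.sinh]; ring
  simp only [e]
  rw [integral_const_mul, integral_add, h.integral_cosh hα, h.integral_mul_sinh hα]
  · ring
  · exact h.integrable_continuous (by fun_prop)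
  · exact h.integrable_continuous (by fun_prop)

/-- At z = iu, cosh and sinh become cos and i sin, bounded by 1, so Poisson's integrals are bounded
by the mass of `ν`. This gives integrability against the Gaussian weight. -/
theorem exists_bound_psi (h : IsPoissonMeasure α ν) (hα : -1 < α) :
    ∃ M : ℝ, ∀ u : ℝ, ‖besselClifford α (-((u : ℂ) ^ 2) / 4)‖ ≤ M ∧
      ‖u / 2 * besselClifford (α + 1) (-((u : ℂ) ^ 2) / 4)‖ ≤ M := by
  refine ⟨2 * (1 * ν.real univ), fun u => ?_⟩
  have := h.finite
  have e : (Complex.I * u) ^ 2 / 4 = -((u : ℂ) ^ 2) / 4 := by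
    rw [mul_pow, Complex.I_sq]; ring
  have e1 : ∀ s : ℝ, Complex.I * u * s = ((u * s : ℝ) : ℂ) * Complex.I := fun s => by
    push_cast; ring
  have h1 := h.integral_cosh hα (Complex.I * u)
  have h2 := h.integral_mul_sinh hα (Complex.I * u)
  simp only [e, e1, Complex.cosh_mul_I, Complex.sinh_mul_I] at h1 h2
  constructor
  · have e2 : besselClifford α (-((u : ℂ) ^ 2) / 4) =
        2 * ∫ s : ℝ, Complex.cos ((u * s : ℝ) : ℂ) ∂ν := by rw [h1]; ring
    rw [e2, norm_mul, Complex.norm_ofNat]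
    gcongr
    refine norm_integral_le_of_norm_le_const (h.ae_mem.mono fun s hs => ?_)
    rw [← Complex.ofReal_cos, Complex.norm_real]
    exact Real.abs_cos_le_one _
  · have e2 : (u / 2 * besselClifford (α + 1) (-((u : ℂ) ^ 2) / 4) : ℂ) = -Complex.I *
        (2 * ∫ s : ℝ, s * (Complex.sin ((u * s : ℝ) : ℂ) * Complex.I) ∂ν) := by
      rw [h2]; ring_nf; rw [Complex.I_sq]; ring
    rw [e2, norm_mul, norm_neg, Complex.norm_I, one_mul, norm_mul, Complex.norm_ofNat]
    gcongr
    refine norm_integral_le_of_norm_le_const (h.ae_mem.mono fun s hs => ?_)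
    rw [← Complex.ofReal_sin, norm_mul, norm_mul, Complex.norm_I, mul_one, Complex.norm_real,
      Complex.norm_real, Real.norm_of_nonneg hs.1]
    calc s * ‖Real.sin (u * s)‖ ≤ 1 * 1 :=
          mul_le_mul hs.2 (Real.abs_sin_le_one _) (norm_nonneg _) zero_le_one
      _ = 1 := one_mul 1

end IsPoissonMeasure

/-! ### The heat kernel. -/

theorem integral_eq_integral_Ioi_add_neg {f : ℝ → ℂ} (h1 : IntegrableOn f (Ioi 0))
    (h2 : IntegrableOn (fun u => f (-u)) (Ioi 0)) :
    ∫ u, f u = ∫ u in Ioi (0 : ℝ), (f u + f (-u)) := by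
  have h3 : IntegrableOn f (Iic 0) := by
    rw [integrableOn_Iic_iff_integrableOn_Iio,
      ← (Measure.measurePreserving_neg (volume : Measure ℝ)).integrableOn_comp_preimage
        (Homeomorph.neg ℝ).measurableEmbedding]
    simpa [Function.comp_def] using h2
  rw [integral_add h1 h2, ← intervalIntegral.integral_Iic_add_Ioi h3 h1, add_comm,
    integral_comp_neg_Ioi, neg_zero]

theorem integrableOn_gaussian_mul_of_bound {α t : ℝ} (hα : -1 < α) (ht : 0 < t) {B : ℝ → ℂ}
    (hB : Measurable B) {C : ℝ} (hC : ∀ u, ‖B u‖ ≤ C) :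
    IntegrableOn (fun u : ℝ => ((u ^ (2 * α + 1) * Real.exp (-t * u ^ (2 : ℝ)) : ℝ) : ℂ) * B u)
      (Ioi 0) := by
  have h := integrableOn_rpow_mul_gaussian (q := α + 1) (by linarith) ht
  rw [show 2 * (α + 1) - 1 = 2 * α + 1 by ring] at h
  exact Integrable.mul_bdd h.ofReal hB.aestronglyMeasurable (Filter.Eventually.of_forall hC)

theorem conj_psi (α u : ℝ) : (starRingEnd ℂ) (psi α u) = psi α (-u) := by
  simp only [psi, abs_neg, map_mul, map_add, Complex.conj_ofReal, Complex.conj_I, map_div₀, map_one,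
    map_ofNat]
  push_cast
  ring

theorem measurable_psi {α : ℝ} (hα : -1 < α) : Measurable (psi α) := by
  have h1 := measurable_besselClifford hα
  have h2 := measurable_besselClifford (α := α + 1) (by linarith)
  have e : psi α = fun u : ℝ => ((2 ^ (-α - 1) : ℝ) : ℂ) *
      (besselClifford α (-((u : ℂ) ^ 2) / 4) +
      Complex.I * u / 2 * besselClifford (α + 1) (-((u : ℂ) ^ 2) / 4)) := funext (psi_eq α)
  rw [e]
  fun_prop

theorem IsPoissonMeasure.exists_norm_psi_le {α : ℝ} {ν : Measure ℝ} (h : IsPoissonMeasure α ν)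
    (hα : -1 < α) : ∃ C, ∀ u, ‖psi α u‖ ≤ C := by
  obtain ⟨M, hM⟩ := h.exists_bound_psi hα
  refine ⟨‖((2 ^ (-α - 1) : ℝ) : ℂ)‖ * (M + M), fun u => ?_⟩
  rw [psi_eq, norm_mul]
  gcongr
  refine (norm_add_le _ _).trans (add_le_add (hM u).1 ?_)
  rw [mul_div_assoc, mul_assoc, norm_mul, Complex.norm_I, one_mul]
  exact (hM u).2

/-- Adding the values at `u` and `-u` cancels the cross terms, leaving products of two functions of
equal order, to which Weber's integral applies. -/
theorem psi_mul_psi_symm (α x y u : ℝ) :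
    psi α (x * u) * psi α (-(y * u)) + psi α (-(x * u)) * psi α (y * u) =
      ((2 * 4 ^ (-α - 1) : ℝ) : ℂ) *
        (besselClifford α (-((x : ℂ) ^ 2) / 4 * (u : ℂ) ^ 2) *
          besselClifford α (-((y : ℂ) ^ 2) / 4 * (u : ℂ) ^ 2) +
        x * y / 4 * (u : ℂ) ^ 2 * (besselClifford (α + 1) (-((x : ℂ) ^ 2) / 4 * (u : ℂ) ^ 2) *
          besselClifford (α + 1) (-((y : ℂ) ^ 2) / 4 * (u : ℂ) ^ 2))) := by
  have e4 : (4 : ℝ) ^ (-α - 1) = 2 ^ (-α - 1) * 2 ^ (-α - 1) := by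
    rw [← Real.mul_rpow (by norm_num) (by norm_num)]; norm_num
  have e1 : ∀ w : ℝ, -(((w * u : ℝ) : ℂ) ^ 2) / 4 = -((w : ℂ) ^ 2) / 4 * (u : ℂ) ^ 2 :=
    fun w => by push_cast; ring
  have e2 : ∀ w : ℝ, -(((-(w * u) : ℝ) : ℂ) ^ 2) / 4 = -((w : ℂ) ^ 2) / 4 * (u : ℂ) ^ 2 :=
    fun w => by push_cast; ring
  simp only [psi_eq, e1, e2, e4]
  push_cast
  ring_nf
  simp only [Complex.I_sq]
  ring

theorem heatKernel_eq_integral_Ioi {α t : ℝ} {ν : Measure ℝ} (h : IsPoissonMeasure α ν)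
    (hα : -1 < α) (ht : 0 < t) (x y : ℝ) :
    heatKernel α t x y = ∫ u in Ioi (0 : ℝ),
      ((u ^ (2 * α + 1) * Real.exp (-t * u ^ (2 : ℝ)) : ℝ) : ℂ) *
        (psi α (x * u) * psi α (-(y * u)) + psi α (-(x * u)) * psi α (y * u)) := by
  obtain ⟨C, hC⟩ := h.exists_norm_psi_le hα
  have hC0 : 0 ≤ C := (norm_nonneg _).trans (hC 0)
  have hmeas := measurable_psi hα
  have hbound : ∀ v w, ‖psi α v * psi α w‖ ≤ C * C := fun v w => by
    rw [norm_mul]; exact mul_le_mul (hC v) (hC w) (norm_nonneg _) hC0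
  have hexp : ∀ u : ℝ, Real.exp (-t * u ^ (2 : ℝ)) = Real.exp (-(u ^ 2 * t)) := fun u => by
    rw [Real.rpow_two]; ring_nf
  rw [heatKernel, wMeasure, integral_withDensity_eq_integral_toReal_smul
    (by fun_prop) (Filter.Eventually.of_forall fun u => ENNReal.ofReal_lt_top)]
  have e1 : ∀ u ∈ Ioi (0 : ℝ), (ENNReal.ofReal (|u| ^ (2 * α + 1))).toReal •
      ((Real.exp (-(u ^ 2 * t)) : ℂ) * psi α (x * u) * (starRingEnd ℂ) (psi α (y * u))) =
      ((u ^ (2 * α + 1) * Real.exp (-t * u ^ (2 : ℝ)) : ℝ) : ℂ) *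
        (psi α (x * u) * psi α (-(y * u))) := fun u hu => by
    rw [ENNReal.toReal_ofReal (by positivity), abs_of_pos hu, hexp, conj_psi, Complex.real_smul]
    push_cast
    ring
  have e2 : ∀ u ∈ Ioi (0 : ℝ), (ENNReal.ofReal (|-u| ^ (2 * α + 1))).toReal •
      ((Real.exp (-((-u) ^ 2 * t)) : ℂ) * psi α (x * -u) * (starRingEnd ℂ) (psi α (y * -u))) =
      ((u ^ (2 * α + 1) * Real.exp (-t * u ^ (2 : ℝ)) : ℝ) : ℂ) *
        (psi α (-(x * u)) * psi α (y * u)) := fun u hu => by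
    rw [ENNReal.toReal_ofReal (by positivity), abs_neg, abs_of_pos hu, hexp, conj_psi,
      Complex.real_smul, mul_neg, mul_neg, neg_neg, neg_sq]
    push_cast
    ring
  rw [integral_eq_integral_Ioi_add_neg]
  · refine setIntegral_congr_fun measurableSet_Ioi fun u hu => ?_
    rw [e1 u hu, e2 u hu, ← mul_add]
  · refine IntegrableOn.congr_fun ?_ (fun u hu => (e1 u hu).symm) measurableSet_Ioi
    exact integrableOn_gaussian_mul_of_bound hα ht (by fun_prop) (fun u => hbound _ _)
  · refine IntegrableOn.congr_fun ?_ (fun u hu => (e2 u hu).symm) measurableSet_Ioi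
    exact integrableOn_gaussian_mul_of_bound hα ht (by fun_prop) (fun u => hbound _ _)

/-- Weber's integrals of orders `α` and `α + 1` share the exponential and the argument; the second
has an extra factor 1/t, which turns xy/4 into z/2 for z = xy/(2t). -/
theorem heatKernel_eq_besselClifford {α t : ℝ} {ν : Measure ℝ} (h : IsPoissonMeasure α ν)
    (hα : -1 < α) (ht : 0 < t) (x y : ℝ) :
    heatKernel α t x y = (((4 * t) ^ (-(α + 1)) : ℝ) : ℂ) *
      (Complex.exp (-((x ^ 2 + y ^ 2 : ℝ) : ℂ) / (4 * t)) *
        (besselClifford α ((x * y / (2 * t) : ℂ) ^ 2 / 4) +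
          (x * y / (2 * t) : ℂ) / 2 * besselClifford (α + 1) ((x * y / (2 * t) : ℂ) ^ 2 / 4))) := by
  have hα' : -1 < α + 1 := by linarith
  have ht' : (t : ℂ) ≠ 0 := by exact_mod_cast ht.ne'
  obtain ⟨M, hM⟩ := h.exists_bound_psi hα
  have hM0 : 0 ≤ M := (norm_nonneg _).trans (hM 0).1
  have m1 := measurable_besselClifford hα
  have m2 := measurable_besselClifford hα'
  have eq4 : ∀ w u : ℝ, -((w : ℂ) ^ 2) / 4 * (u : ℂ) ^ 2 = -(((w * u : ℝ) : ℂ) ^ 2) / 4 :=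
    fun w u => by push_cast; ring
  rw [heatKernel_eq_integral_Ioi h hα ht]
  have e : ∀ u ∈ Ioi (0 : ℝ), ((u ^ (2 * α + 1) * Real.exp (-t * u ^ (2 : ℝ)) : ℝ) : ℂ) *
        (psi α (x * u) * psi α (-(y * u)) + psi α (-(x * u)) * psi α (y * u)) =
      ((2 * 4 ^ (-α - 1) : ℝ) : ℂ) *
      (((u ^ (2 * α + 1) * Real.exp (-t * u ^ (2 : ℝ)) : ℝ) : ℂ) *
        (besselClifford α (-((x : ℂ) ^ 2) / 4 * (u : ℂ) ^ 2) *
          besselClifford α (-((y : ℂ) ^ 2) / 4 * (u : ℂ) ^ 2)) +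
      x * y / 4 * (((u ^ (2 * (α + 1) + 1) * Real.exp (-t * u ^ (2 : ℝ)) : ℝ) : ℂ) *
        (besselClifford (α + 1) (-((x : ℂ) ^ 2) / 4 * (u : ℂ) ^ 2) *
          besselClifford (α + 1) (-((y : ℂ) ^ 2) / 4 * (u : ℂ) ^ 2)))) := fun u hu => by
    have hu' : (0 : ℝ) < u := hu
    have : u ^ (2 * (α + 1) + 1) = u ^ (2 * α + 1) * u ^ 2 := by
      rw [show 2 * (α + 1) + 1 = 2 * α + 1 + 2 by ring, Real.rpow_add hu', Real.rpow_two]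
    rw [psi_mul_psi_symm, this]
    push_cast
    ring
  have i1 : IntegrableOn (fun u : ℝ =>
      ((u ^ (2 * α + 1) * Real.exp (-t * u ^ (2 : ℝ)) : ℝ) : ℂ) *
        (besselClifford α (-((x : ℂ) ^ 2) / 4 * (u : ℂ) ^ 2) *
          besselClifford α (-((y : ℂ) ^ 2) / 4 * (u : ℂ) ^ 2))) (Ioi 0) := by
    refine integrableOn_gaussian_mul_of_bound (C := M * M) hα ht (by fun_prop) fun u => ?_
    rw [norm_mul, eq4, eq4]
    exact mul_le_mul (hM _).1 (hM _).1 (norm_nonneg _) hM0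
  have i2 : IntegrableOn (fun u : ℝ =>
      x * y / 4 * (((u ^ (2 * (α + 1) + 1) * Real.exp (-t * u ^ (2 : ℝ)) : ℝ) : ℂ) *
        (besselClifford (α + 1) (-((x : ℂ) ^ 2) / 4 * (u : ℂ) ^ 2) *
          besselClifford (α + 1) (-((y : ℂ) ^ 2) / 4 * (u : ℂ) ^ 2)))) (Ioi 0) := by
    -- The factor u² from the higher order is shared between the two functions, since only `u / 2`
    -- times the function of order `α + 1` has been bounded.
    have := integrableOn_gaussian_mul_of_bound (C := M * M) (B := fun u : ℝ =>
      ((x * u : ℝ) / 2 * besselClifford (α + 1) (-(((x * u : ℝ) : ℂ) ^ 2) / 4)) *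
      ((y * u : ℝ) / 2 * besselClifford (α + 1) (-(((y * u : ℝ) : ℂ) ^ 2) / 4))) hα ht
      (by fun_prop) (fun u => by
        rw [norm_mul]
        exact mul_le_mul (hM _).2 (hM _).2 (norm_nonneg _) hM0)
    refine this.congr_fun (fun u hu => ?_) measurableSet_Ioi
    have hu' : (0 : ℝ) < u := hu
    have : u ^ (2 * (α + 1) + 1) = u ^ (2 * α + 1) * u ^ 2 := by
      rw [show 2 * (α + 1) + 1 = 2 * α + 1 + 2 by ring, Real.rpow_add hu', Real.rpow_two]
    simp only [eq4, this]
    push_cast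
    ring
  rw [setIntegral_congr_fun measurableSet_Ioi e, integral_const_mul, integral_add i1 i2,
    integral_const_mul, integral_gaussian_mul_besselClifford hα ht,
    integral_gaussian_mul_besselClifford hα' ht]
  have ez : -((x : ℂ) ^ 2) / 4 / t * (-((y : ℂ) ^ 2) / 4 / t) = (x * y / (2 * t) : ℂ) ^ 2 / 4 := by
    field_simp; ring
  have ee : -((x : ℂ) ^ 2) / 4 / t + -((y : ℂ) ^ 2) / 4 / t =
      -((x ^ 2 + y ^ 2 : ℝ) : ℂ) / (4 * t) := by
    push_cast; field_simp; ring
  have e5 : t ^ (-(α + 1 + 1)) = t ^ (-(α + 1)) * t⁻¹ := by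
    rw [neg_add (α + 1), Real.rpow_add ht, Real.rpow_neg_one]
  have e6 : (4 * t) ^ (-(α + 1)) = 4 ^ (-α - 1) * t ^ (-(α + 1)) := by
    rw [Real.mul_rpow (by norm_num) ht.le, neg_add']
  rw [ez, ee, e5, e6]
  push_cast
  field_simp
  ring

/-- The heat kernel as a superposition of Gaussians. -/
theorem heatKernel_eq_integral {α t : ℝ} {ν : Measure ℝ} (h : IsPoissonMeasure α ν)
    (hα : -1 < α) (ht : 0 < t) (x y : ℝ) :
    heatKernel α t x y = (((4 * t) ^ (-(α + 1)) *
      ∫ s, (Real.exp (-(x ^ 2 + y ^ 2 - 2 * x * y * s) / (4 * t)) * (1 + s) +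
        Real.exp (-(x ^ 2 + y ^ 2 + 2 * x * y * s) / (4 * t)) * (1 - s)) ∂ν : ℝ) : ℂ) := by
  have ht' : (t : ℂ) ≠ 0 := by exact_mod_cast ht.ne'
  rw [heatKernel_eq_besselClifford h hα ht, ← h.integral_dunkl hα, Complex.ofReal_mul,
    ← integral_const_mul, ← integral_complex_ofReal]
  congr 1
  refine integral_congr_ae (Filter.Eventually.of_forall fun s => ?_)
  simp only
  push_cast
  rw [mul_add, ← mul_assoc, ← mul_assoc, ← Complex.exp_add, ← Complex.exp_add]
  congr 3
  · field_simp; ring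
  · field_simp; ring

theorem heatKernel_im_eq_zero {α t : ℝ} {ν : Measure ℝ} (h : IsPoissonMeasure α ν)
    (hα : -1 < α) (ht : 0 < t) (x y : ℝ) : (heatKernel α t x y).im = 0 := by
  rw [heatKernel_eq_integral h hα ht, Complex.ofReal_im]

theorem heatKernel_re_nonneg {α t : ℝ} {ν : Measure ℝ} (h : IsPoissonMeasure α ν)
    (hα : -1 < α) (ht : 0 < t) (x y : ℝ) : 0 ≤ (heatKernel α t x y).re := by
  rw [heatKernel_eq_integral h hα ht, Complex.ofReal_re]
  refine mul_nonneg (by positivity) (integral_nonneg_of_ae (h.ae_mem.mono fun s hs => ?_))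
  have h1 : 0 ≤ 1 + s := by linarith [hs.1]
  have h2 : 0 ≤ 1 - s := by linarith [hs.2]
  simp only [Pi.zero_apply]
  positivity

/-! ### The Riesz kernel as a superposition of powers. -/

/-- For `D > 0` the substitution v = 1/t gives a Gamma integral. For `D = 0` both sides are
infinite, so the formula holds on the singular set too. -/
theorem lintegral_rpow_mul_exp_neg_div {β D : ℝ} (hβ : 0 < β) (hD : 0 ≤ D) :
    ∫⁻ t in Ioi (0 : ℝ), ENNReal.ofReal (t ^ (-β - 1) * Real.exp (-D / (4 * t))) =
      ENNReal.ofReal (Real.Gamma β * 4 ^ β) * ENNReal.ofReal D ^ (-β) := by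
  have hG := Real.Gamma_pos_of_pos hβ
  rcases hD.eq_or_lt with rfl | hD
  · rw [ENNReal.ofReal_zero, ENNReal.zero_rpow_of_neg (by linarith), ENNReal.mul_top
      (by rw [ne_eq, ENNReal.ofReal_eq_zero, not_le]; positivity)]
    by_contra hfin
    refine not_integrableOn_Ioi_rpow (-β - 1) ⟨by fun_prop, ?_⟩
    rw [hasFiniteIntegral_iff_ofReal]
    · simpa using lt_top_iff_ne_top.mpr hfin
    · exact (ae_restrict_iff' measurableSet_Ioi).mpr
        (Filter.Eventually.of_forall fun t ht => Real.rpow_nonneg (le_of_lt ht) _)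
  · have e : ∀ t ∈ Ioi (0 : ℝ), t ^ (-β - 1) * Real.exp (-D / (4 * t)) =
        (|(-1 : ℝ)| * t ^ ((-1 : ℝ) - 1)) •
          ((t ^ (-1 : ℝ)) ^ (β - 1) * Real.exp (-(D / 4 * t ^ (-1 : ℝ)))) := fun t ht => by
      have ht' : (0 : ℝ) < t := ht
      rw [abs_neg, abs_one, one_mul, smul_eq_mul, ← mul_assoc, ← Real.rpow_mul ht'.le,
        ← Real.rpow_add ht', Real.rpow_neg_one]
      congr 2
      · ring
      · field_simp
    have hint : IntegrableOn (fun v : ℝ => v ^ (β - 1) * Real.exp (-(D / 4 * v))) (Ioi 0) := by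
      have := integrableOn_rpow_mul_exp_neg_mul_rpow (p := 1) (s := β - 1) (b := D / 4)
        (by linarith) one_pos (by positivity)
      simpa [neg_mul] using this
    have hint' : IntegrableOn (fun t : ℝ => t ^ (-β - 1) * Real.exp (-D / (4 * t))) (Ioi 0) :=
      ((integrableOn_Ioi_comp_rpow_iff _ (by norm_num : (-1 : ℝ) ≠ 0)).mpr hint).congr_fun
        (fun t ht => (e t ht).symm) measurableSet_Ioi
    rw [← ofReal_integral_eq_lintegral_ofReal hint', setIntegral_congr_fun measurableSet_Ioi e,
      integral_comp_rpow_Ioi (fun v : ℝ => v ^ (β - 1) * Real.exp (-(D / 4 * v))) (by norm_num),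
      Real.integral_rpow_mul_exp_neg_mul_Ioi hβ (by positivity), ENNReal.ofReal_rpow_of_pos hD,
      ← ENNReal.ofReal_mul (by positivity)]
    · congr 1
      rw [one_div_div, Real.div_rpow (by norm_num) hD.le, Real.rpow_neg hD.le]
      ring
    · exact (ae_restrict_iff' measurableSet_Ioi).mpr
        (Filter.Eventually.of_forall fun t ht => by
          have ht' : (0 : ℝ) < t := ht
          simp only [Pi.zero_apply]
          positivity)

theorem sq_add_sq_sub_nonneg {x y s : ℝ} (hs : |s| ≤ 1) : 0 ≤ x ^ 2 + y ^ 2 - 2 * x * y * s := by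
  have h := abs_le.mp hs
  nlinarith [mul_nonneg (sq_nonneg (x - y)) (by linarith : 0 ≤ 1 + s),
    mul_nonneg (sq_nonneg (x + y)) (by linarith : 0 ≤ 1 - s)]

/-- The Riesz kernel as a superposition of negative powers. -/
theorem rieszKernel_eq_lintegral {α σ : ℝ} {ν : Measure ℝ} (h : IsPoissonMeasure α ν)
    (hα : -1 < α) (hσ : 0 < σ) (hσα : σ < α + 1) (x y : ℝ) :
    rieszKernel α σ x y =
      ENNReal.ofReal (Real.Gamma (α + 1 - σ) * 4 ^ (-σ) / Real.Gamma σ) *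
      ∫⁻ s, (ENNReal.ofReal (1 + s) *
          ENNReal.ofReal (x ^ 2 + y ^ 2 - 2 * x * y * s) ^ (-(α + 1 - σ)) +
        ENNReal.ofReal (1 - s) *
          ENNReal.ofReal (x ^ 2 + y ^ 2 + 2 * x * y * s) ^ (-(α + 1 - σ))) ∂ν := by
  have hfin := h.finite
  have hGσ := Real.Gamma_pos_of_pos hσ
  have hβ : 0 < α + 1 - σ := by linarith
  have hGβ := Real.Gamma_pos_of_pos hβ
  set β := α + 1 - σ with hβdef
  have h1 : ∀ t ∈ Ioi (0 : ℝ), ENNReal.ofReal ((heatKernel α t x y).re * t ^ (σ - 1)) =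
      ∫⁻ s, (ENNReal.ofReal (4 ^ (-(α + 1)) * (1 + s)) * ENNReal.ofReal
          (t ^ (-β - 1) * Real.exp (-(x ^ 2 + y ^ 2 - 2 * x * y * s) / (4 * t))) +
        ENNReal.ofReal (4 ^ (-(α + 1)) * (1 - s)) * ENNReal.ofReal
          (t ^ (-β - 1) * Real.exp (-(x ^ 2 + y ^ 2 + 2 * x * y * s) / (4 * t)))) ∂ν := by
    intro t ht
    have ht' : (0 : ℝ) < t := ht
    have ec : (4 * t) ^ (-(α + 1)) * t ^ (σ - 1) = 4 ^ (-(α + 1)) * t ^ (-β - 1) := by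
      rw [Real.mul_rpow (by norm_num) ht'.le, mul_assoc, ← Real.rpow_add ht']
      congr 2
      simp only [hβdef]; ring
    rw [heatKernel_eq_integral h hα ht', Complex.ofReal_re, mul_right_comm, ec,
      ← integral_const_mul, ofReal_integral_eq_lintegral_ofReal]
    · refine lintegral_congr_ae (h.ae_mem.mono fun s hs => ?_)
      have h1 : 0 ≤ 1 + s := by linarith [hs.1]
      have h2 : 0 ≤ 1 - s := by linarith [hs.2]
      simp only
      rw [← ENNReal.ofReal_mul (by positivity), ← ENNReal.ofReal_mul (by positivity),
        ← ENNReal.ofReal_add (by positivity) (by positivity)]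
      congr 1
      ring
    · exact h.integrable_continuous (by fun_prop)
    · refine h.ae_mem.mono fun s hs => ?_
      have h1 : 0 ≤ 1 + s := by linarith [hs.1]
      have h2 : 0 ≤ 1 - s := by linarith [hs.2]
      simp only [Pi.zero_apply]
      positivity
  -- Tonelli: the integrand is nonnegative, so no finiteness of the kernel is needed.
  rw [rieszKernel, setLIntegral_congr_fun measurableSet_Ioi h1, lintegral_lintegral_swap
    (by fun_prop)]
  have h2 : ∀ s ∈ Icc (0 : ℝ) 1, ∫⁻ t in Ioi (0 : ℝ),
      (ENNReal.ofReal (4 ^ (-(α + 1)) * (1 + s)) * ENNReal.ofReal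
          (t ^ (-β - 1) * Real.exp (-(x ^ 2 + y ^ 2 - 2 * x * y * s) / (4 * t))) +
        ENNReal.ofReal (4 ^ (-(α + 1)) * (1 - s)) * ENNReal.ofReal
          (t ^ (-β - 1) * Real.exp (-(x ^ 2 + y ^ 2 + 2 * x * y * s) / (4 * t)))) =
      ENNReal.ofReal (4 ^ (-(α + 1)) * (Real.Gamma β * 4 ^ β)) * (ENNReal.ofReal (1 + s) *
          ENNReal.ofReal (x ^ 2 + y ^ 2 - 2 * x * y * s) ^ (-β) +
        ENNReal.ofReal (1 - s) *
          ENNReal.ofReal (x ^ 2 + y ^ 2 + 2 * x * y * s) ^ (-β)) := by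
    intro s hs
    have h3 : 0 ≤ x ^ 2 + y ^ 2 - 2 * x * y * s :=
      sq_add_sq_sub_nonneg (by rw [abs_of_nonneg hs.1]; exact hs.2)
    have h4 : 0 ≤ x ^ 2 + y ^ 2 + 2 * x * y * s := by
      have := sq_add_sq_sub_nonneg (x := x) (y := y) (s := -s)
        (by rw [abs_neg, abs_of_nonneg hs.1]; exact hs.2)
      linarith
    rw [lintegral_add_left (by fun_prop), lintegral_const_mul _ (by fun_prop),
      lintegral_const_mul _ (by fun_prop), lintegral_rpow_mul_exp_neg_div hβ h3,
      lintegral_rpow_mul_exp_neg_div hβ h4, ENNReal.ofReal_mul (q := 1 + s) (by positivity),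
      ENNReal.ofReal_mul (q := 1 - s) (by positivity),
      ENNReal.ofReal_mul (q := Real.Gamma β * 4 ^ β) (by positivity)]
    ring
  rw [lintegral_congr_ae (h.ae_mem.mono h2), lintegral_const_mul _ (by fun_prop), ← mul_assoc,
    ← ENNReal.ofReal_mul (by positivity)]
  congr 2
  have e : (4 : ℝ) ^ (-σ) = 4 ^ (-(α + 1)) * 4 ^ β := by
    rw [← Real.rpow_add (by norm_num)]; congr 1; simp only [hβdef]; ring
  rw [e]
  ring

/-! ### Existence of Poisson measures. -/

theorem Gamma_nat_add_half_mul (k : ℕ) :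
    Real.Gamma (k + 1 / 2) * (4 ^ k * k.factorial) = (2 * k).factorial * √Real.pi := by
  induction k with
  | zero => simp [-one_div, Real.Gamma_one_half_eq]
  | succ k ih =>
    have e1 : Real.Gamma ((k + 1 : ℕ) + 1 / 2) = (k + 1 / 2) * Real.Gamma (k + 1 / 2) := by
      rw [← Real.Gamma_add_one (by positivity)]; push_cast; ring_nf
    rw [e1, show 2 * (k + 1) = 2 * k + 1 + 1 by ring, Nat.factorial_succ, Nat.factorial_succ,
      Nat.factorial_succ, pow_succ]
    push_cast
    linear_combination (4 * (k + 1 / 2) * (k + 1) : ℝ) * ih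

/-- Both claims are read off from the fact that the Beta density has total mass one. -/
theorem integrableOn_and_integral_beta {a b : ℝ} (ha : 0 < a) (hb : 0 < b) :
    IntegrableOn (fun x : ℝ => x ^ (a - 1) * (1 - x) ^ (b - 1)) (Ioo 0 1) ∧
    ∫ x in Ioo (0 : ℝ) 1, x ^ (a - 1) * (1 - x) ^ (b - 1) =
      Real.Gamma a * Real.Gamma b / Real.Gamma (a + b) := by
  have hB := ProbabilityTheory.beta_pos ha hb
  have h1 := ProbabilityTheory.lintegral_betaPDF_eq_one ha hb
  rw [ProbabilityTheory.lintegral_betaPDF] at h1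
  have hnn : 0 ≤ᵐ[volume.restrict (Ioo (0 : ℝ) 1)]
      fun x => 1 / ProbabilityTheory.beta a b * x ^ (a - 1) * (1 - x) ^ (b - 1) :=
    (ae_restrict_iff' measurableSet_Ioo).mpr (Filter.Eventually.of_forall fun x hx => by
      have h2 : 0 < x := hx.1
      have h3 : 0 < 1 - x := by linarith [hx.2]
      simp only [Pi.zero_apply]
      positivity)
  have hint : IntegrableOn (fun x : ℝ => 1 / ProbabilityTheory.beta a b * x ^ (a - 1) *
      (1 - x) ^ (b - 1)) (Ioo 0 1) := by
    refine ⟨by fun_prop, ?_⟩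
    rw [hasFiniteIntegral_iff_ofReal hnn, h1]
    exact ENNReal.one_lt_top
  rw [← ofReal_integral_eq_lintegral_ofReal hint hnn, ENNReal.ofReal_eq_one] at h1
  simp only [mul_assoc] at h1 hint
  rw [integral_const_mul] at h1
  constructor
  · have := hint.const_mul (ProbabilityTheory.beta a b)
    refine this.congr (Filter.Eventually.of_forall fun x => ?_)
    simp only
    field_simp
  · rw [← ProbabilityTheory.beta]
    field_simp at h1
    exact h1

/-- The substitution v = s² reduces this to the Beta integral with parameters k + 1/2 and b. -/
theorem integrableOn_and_integral_pow_mul_one_sub_sq {b : ℝ} (hb : 0 < b) (k : ℕ) :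
    IntegrableOn (fun s : ℝ => s ^ (2 * k) * (1 - s ^ 2) ^ (b - 1)) (Ioo 0 1) ∧
    ∫ s in Ioo (0 : ℝ) 1, s ^ (2 * k) * (1 - s ^ 2) ^ (b - 1) =
      1 / 2 * (Real.Gamma (k + 1 / 2) * Real.Gamma b / Real.Gamma (k + 1 / 2 + b)) := by
  obtain ⟨h1, h2⟩ := integrableOn_and_integral_beta (a := k + 1 / 2) (by positivity) hb
  have himg : (fun s : ℝ => s ^ 2) '' Ioo 0 1 = Ioo 0 1 := by
    ext v
    constructor
    · rintro ⟨s, hs, rfl⟩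
      exact ⟨pow_pos hs.1 2, pow_lt_one₀ hs.1.le hs.2 two_ne_zero⟩
    · intro hv
      exact ⟨√v, ⟨Real.sqrt_pos.mpr hv.1, by
        rw [Real.sqrt_lt' one_pos]; simpa using hv.2⟩, Real.sq_sqrt hv.1.le⟩
  have hinj : InjOn (fun s : ℝ => s ^ 2) (Ioo 0 1) := fun s hs r hr h =>
    (pow_left_inj₀ hs.1.le hr.1.le two_ne_zero).mp h
  have hder : ∀ s ∈ Ioo (0 : ℝ) 1, HasDerivWithinAt (fun s : ℝ => s ^ 2) (2 * s) (Ioo 0 1) s :=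
    fun s _ => by simpa using (hasDerivAt_pow 2 s).hasDerivWithinAt
  have e : ∀ s ∈ Ioo (0 : ℝ) 1, |2 * s| • ((s ^ 2) ^ ((k : ℝ) + 1 / 2 - 1) *
      (1 - s ^ 2) ^ (b - 1)) = 2 * (s ^ (2 * k) * (1 - s ^ 2) ^ (b - 1)) := fun s hs => by
    have h0 : 0 < s := hs.1
    have : (s ^ 2) ^ ((k : ℝ) + 1 / 2 - 1) = s ^ (2 * k) * s⁻¹ := by
      rw [← Real.rpow_two, ← Real.rpow_mul h0.le, ← Real.rpow_natCast, ← Real.rpow_neg_one,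
        ← Real.rpow_add h0]
      congr 1; push_cast; ring
    rw [this, abs_of_pos (by positivity), smul_eq_mul]
    field_simp
  rw [← himg, integrableOn_image_iff_integrableOn_abs_deriv_smul measurableSet_Ioo hder hinj,
    integrableOn_congr_fun e measurableSet_Ioo] at h1
  rw [← himg, integral_image_eq_integral_abs_deriv_smul measurableSet_Ioo hder hinj,
    setIntegral_congr_fun measurableSet_Ioo e, integral_const_mul] at h2
  constructor
  · have := h1.const_mul (1 / 2)
    refine this.congr (Filter.Eventually.of_forall fun x => ?_)
    simp only
    ring
  · rw [← h2]; ring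

/-- Poisson's measure for `α > -1/2`. -/
def poissonMeasure (α : ℝ) : Measure ℝ :=
  (volume.restrict (Ioo (0 : ℝ) 1)).withDensity fun s =>
    ENNReal.ofReal ((√Real.pi * Real.Gamma (α + 1 / 2))⁻¹ * (1 - s ^ 2) ^ (α + 1 / 2 - 1))

theorem isPoissonMeasure_poissonMeasure {α : ℝ} (hα : -1 / 2 < α) :
    IsPoissonMeasure α (poissonMeasure α) := by
  have hb : 0 < α + 1 / 2 := by linarith
  have hG := Real.Gamma_pos_of_pos hb
  have hmem : ∀ᵐ s ∂(volume.restrict (Ioo (0 : ℝ) 1)), s ∈ Ioo (0 : ℝ) 1 :=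
    ae_restrict_mem measurableSet_Ioo
  have hpos : ∀ s ∈ Ioo (0 : ℝ) 1,
      0 ≤ (√Real.pi * Real.Gamma (α + 1 / 2))⁻¹ * (1 - s ^ 2) ^ (α + 1 / 2 - 1) := fun s hs => by
    have : 0 < 1 - s ^ 2 := by nlinarith [hs.1, hs.2]
    positivity
  refine ⟨?_, ?_, fun k => ?_⟩
  · refine isFiniteMeasure_withDensity_ofReal ?_
    have := (integrableOn_and_integral_pow_mul_one_sub_sq hb 0).1.const_mul
      (√Real.pi * Real.Gamma (α + 1 / 2))⁻¹
    simp only [mul_zero, pow_zero, one_mul] at this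
    exact this.2
  · exact (withDensity_absolutelyContinuous _ _).ae_le (hmem.mono fun s hs => ⟨hs.1.le, hs.2.le⟩)
  · rw [poissonMeasure, integral_withDensity_eq_integral_toReal_smul (by fun_prop)
      (Filter.Eventually.of_forall fun u => ENNReal.ofReal_lt_top)]
    have e : ∀ s ∈ Ioo (0 : ℝ) 1, (ENNReal.ofReal ((√Real.pi * Real.Gamma (α + 1 / 2))⁻¹ *
        (1 - s ^ 2) ^ (α + 1 / 2 - 1))).toReal • s ^ (2 * k) =
        (√Real.pi * Real.Gamma (α + 1 / 2))⁻¹ *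
          (s ^ (2 * k) * (1 - s ^ 2) ^ (α + 1 / 2 - 1)) := fun s hs => by
      rw [ENNReal.toReal_ofReal (hpos s hs), smul_eq_mul]; ring
    rw [setIntegral_congr_fun measurableSet_Ioo e, integral_const_mul,
      (integrableOn_and_integral_pow_mul_one_sub_sq hb k).2,
      show (k : ℝ) + 1 / 2 + (α + 1 / 2) = k + α + 1 by ring]
    have h1 := Gamma_nat_add_half_mul k
    have h2 := Gamma_pos (α := α) (by linarith) k
    have h3 : Real.Gamma (k + 1 / 2) = (2 * k).factorial * √Real.pi / (4 ^ k * k.factorial) := by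
      rw [eq_div_iff (by positivity), h1]
    have h4 : 0 < √Real.pi := Real.sqrt_pos.mpr Real.pi_pos
    rw [h3]
    generalize Real.Gamma (α + 1 / 2) = G at hG ⊢
    field_simp

/-- At the endpoint the density (1-s²)^{α-1/2} is no longer integrable; a point mass at 1 takes its
place. -/
theorem isPoissonMeasure_dirac :
    IsPoissonMeasure (-1 / 2) (ENNReal.ofReal (2 * √Real.pi)⁻¹ • Measure.dirac 1) := by
  have h4 : 0 < √Real.pi := Real.sqrt_pos.mpr Real.pi_pos
  refine ⟨?_, ?_, fun k => ?_⟩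
  · exact Measure.smul_finite _ ENNReal.ofReal_ne_top
  · refine Measure.ae_smul_measure ?_ _
    rw [ae_dirac_eq]
    exact ⟨zero_le_one, le_rfl⟩
  · rw [integral_smul_measure, integral_dirac, ENNReal.toReal_ofReal (by positivity), one_pow,
      smul_eq_mul, mul_one, show (k : ℝ) + -1 / 2 + 1 = k + 1 / 2 by ring]
    have h1 := Gamma_nat_add_half_mul k
    have h2 := Real.Gamma_pos_of_pos (show (0 : ℝ) < k + 1 / 2 by positivity)
    rw [eq_div_iff (by positivity), inv_mul_eq_iff_eq_mul₀ (by positivity)]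
    linear_combination 2 * h1

theorem exists_isPoissonMeasure {α : ℝ} (hα : -1 / 2 ≤ α) : ∃ ν, IsPoissonMeasure α ν := by
  rcases hα.eq_or_lt with rfl | h
  · exact ⟨_, isPoissonMeasure_dirac⟩
  · exact ⟨_, isPoissonMeasure_poissonMeasure h⟩

/-! ### Two-sided comparability. -/

/-- Two-sided comparability of `[0, ∞]`-valued functions on a set. -/
def ComparableOn {ι : Type*} (f g : ι → ℝ≥0∞) (s : Set ι) : Prop :=
  ∃ c C : ℝ, 0 < c ∧ 0 < C ∧ ∀ i ∈ s,
    ENNReal.ofReal c * g i ≤ f i ∧ f i ≤ ENNReal.ofReal C * g i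

namespace ComparableOn

variable {ι : Type*} {f g h : ι → ℝ≥0∞} {s t : Set ι}

theorem of_eq (hfg : ∀ i ∈ s, f i = g i) : ComparableOn f g s :=
  ⟨1, 1, one_pos, one_pos, fun i hi => by simp [hfg i hi]⟩

theorem trans (h1 : ComparableOn f g s) (h2 : ComparableOn g h s) : ComparableOn f h s := by
  obtain ⟨c, C, hc, hC, H⟩ := h1
  obtain ⟨c', C', hc', hC', H'⟩ := h2
  refine ⟨c * c', C * C', by positivity, by positivity, fun i hi => ⟨?_, ?_⟩⟩
  · rw [ENNReal.ofReal_mul hc.le, mul_assoc]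
    exact (mul_le_mul_right (H' i hi).1 _).trans (H i hi).1
  · rw [ENNReal.ofReal_mul hC.le, mul_assoc]
    exact (H i hi).2.trans (mul_le_mul_right (H' i hi).2 _)

theorem symm (h1 : ComparableOn f g s) : ComparableOn g f s := by
  obtain ⟨c, C, hc, hC, H⟩ := h1
  have key : ∀ r : ℝ, 0 < r → ∀ v : ℝ≥0∞, ENNReal.ofReal r⁻¹ * (ENNReal.ofReal r * v) = v :=
    fun r hr v => by
      rw [← mul_assoc, ← ENNReal.ofReal_mul (by positivity), inv_mul_cancel₀ hr.ne',
        ENNReal.ofReal_one, one_mul]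
  refine ⟨C⁻¹, c⁻¹, by positivity, by positivity, fun i hi => ⟨?_, ?_⟩⟩
  · calc _ ≤ ENNReal.ofReal C⁻¹ * (ENNReal.ofReal C * g i) := mul_le_mul_right (H i hi).2 _
      _ = g i := key C hC _
  · calc g i = ENNReal.ofReal c⁻¹ * (ENNReal.ofReal c * g i) := (key c hc _).symm
      _ ≤ _ := mul_le_mul_right (H i hi).1 _

theorem union (h1 : ComparableOn f g s) (h2 : ComparableOn f g t) : ComparableOn f g (s ∪ t) := by
  obtain ⟨c, C, hc, hC, H⟩ := h1
  obtain ⟨c', C', hc', hC', H'⟩ := h2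
  refine ⟨min c c', max C C', by positivity, by positivity, fun i hi => ?_⟩
  rcases hi with hi | hi
  · exact ⟨(mul_le_mul_left (ENNReal.ofReal_le_ofReal (min_le_left _ _)) _).trans (H i hi).1,
      (H i hi).2.trans (mul_le_mul_left (ENNReal.ofReal_le_ofReal (le_max_left _ _)) _)⟩
  · exact ⟨(mul_le_mul_left (ENNReal.ofReal_le_ofReal (min_le_right _ _)) _).trans (H' i hi).1,
      (H' i hi).2.trans (mul_le_mul_left (ENNReal.ofReal_le_ofReal (le_max_right _ _)) _)⟩

theorem mul_left (h1 : ComparableOn f g s) (k : ι → ℝ≥0∞) :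
    ComparableOn (fun i => k i * f i) (fun i => k i * g i) s := by
  obtain ⟨c, C, hc, hC, H⟩ := h1
  refine ⟨c, C, hc, hC, fun i hi => ⟨?_, ?_⟩⟩
  · rw [mul_left_comm]; exact mul_le_mul_right (H i hi).1 _
  · rw [mul_left_comm]; exact mul_le_mul_right (H i hi).2 _

theorem comp (h1 : ComparableOn f g s) {κ : Type*} (φ : κ → ι) {u : Set κ} (hφ : MapsTo φ u s) :
    ComparableOn (fun k => f (φ k)) (fun k => g (φ k)) u := by
  obtain ⟨c, C, hc, hC, H⟩ := h1
  exact ⟨c, C, hc, hC, fun i hi => H _ (hφ hi)⟩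

theorem const_mul {a : ℝ} (ha : 0 < a) (f : ι → ℝ≥0∞) (s : Set ι) :
    ComparableOn (fun i => ENNReal.ofReal a * f i) f s :=
  ⟨a, a, ha, ha, fun _ _ => ⟨le_rfl, le_rfl⟩⟩

end ComparableOn

/-! ### The model integral. -/

theorem lintegral_Ioo_rpow {γ a : ℝ} (hγ : -1 < γ) (ha : 0 ≤ a) :
    ∫⁻ r in Ioo 0 a, ENNReal.ofReal (r ^ γ) = ENNReal.ofReal (a ^ (γ + 1) / (γ + 1)) := by
  have hint : IntegrableOn (fun r : ℝ => r ^ γ) (Ioo 0 a) :=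
    ((intervalIntegrable_iff_integrableOn_Ioo_of_le ha).mp
      (intervalIntegral.intervalIntegrable_rpow' hγ))
  rw [← ofReal_integral_eq_lintegral_ofReal hint, ← integral_Ioc_eq_integral_Ioo,
    ← intervalIntegral.integral_of_le ha, integral_rpow (Or.inl hγ), Real.zero_rpow (by linarith),
    sub_zero]
  exact (ae_restrict_iff' measurableSet_Ioo).mpr
    (Filter.Eventually.of_forall fun r hr => Real.rpow_nonneg hr.1.le _)

theorem lintegral_Ico_rpow {κ a : ℝ} (hκ : κ ≠ 0) (ha : 0 < a) (ha1 : a ≤ 1) :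
    ∫⁻ r in Ico a 1, ENNReal.ofReal (r ^ (κ - 1)) = ENNReal.ofReal ((1 - a ^ κ) / κ) := by
  have h0 : (0 : ℝ) ∉ uIcc a 1 := by rw [uIcc_of_le ha1]; exact fun h => absurd h.1 (by linarith)
  have hint : IntegrableOn (fun r : ℝ => r ^ (κ - 1)) (Ico a 1) :=
    ((intervalIntegrable_iff_integrableOn_Ico_of_le ha1).mp
      (intervalIntegral.intervalIntegrable_rpow (Or.inr h0)))
  rw [← ofReal_integral_eq_lintegral_ofReal hint, integral_Ico_eq_integral_Ioo,
    ← integral_Ioc_eq_integral_Ioo,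
    ← intervalIntegral.integral_of_le ha1, integral_rpow (Or.inr ⟨fun h => hκ (by linarith), h0⟩),
    Real.one_rpow, sub_add_cancel]
  exact (ae_restrict_iff' measurableSet_Ico).mpr
    (Filter.Eventually.of_forall fun r hr => Real.rpow_nonneg (ha.le.trans hr.1) _)

theorem lintegral_Ico_inv {a : ℝ} (ha : 0 < a) (ha1 : a ≤ 1) :
    ∫⁻ r in Ico a 1, ENNReal.ofReal (r ^ (-1 : ℝ)) = ENNReal.ofReal (-Real.log a) := by
  have h0 : (0 : ℝ) ∉ uIcc a 1 := by rw [uIcc_of_le ha1]; exact fun h => absurd h.1 (by linarith)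
  have hint : IntegrableOn (fun r : ℝ => r ^ (-1 : ℝ)) (Ico a 1) :=
    ((intervalIntegrable_iff_integrableOn_Ico_of_le ha1).mp
      (intervalIntegral.intervalIntegrable_rpow (Or.inr h0)))
  rw [← ofReal_integral_eq_lintegral_ofReal hint, integral_Ico_eq_integral_Ioo,
    ← integral_Ioc_eq_integral_Ioo, ← intervalIntegral.integral_of_le ha1]
  · simp only [Real.rpow_neg_one]
    rw [integral_inv_of_pos ha one_pos, one_div, Real.log_inv]
  · exact (ae_restrict_iff' measurableSet_Ico).mpr
      (Filter.Eventually.of_forall fun r hr => Real.rpow_nonneg (ha.le.trans hr.1) _)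

/-- The model integral `∫₀¹ (a + r)^{-β} r^γ dr`. -/
def modelIntegral (β γ a : ℝ) : ℝ≥0∞ :=
  ∫⁻ r in Ioo (0 : ℝ) 1, ENNReal.ofReal ((a + r) ^ (-β) * r ^ γ)

/-- The size of the model integral with `κ = γ + 1 - β`. -/
def modelSize (κ a : ℝ) : ℝ≥0∞ :=
  if κ < 0 then ENNReal.ofReal a ^ κ
  else if κ = 0 then if a = 0 then ∞ else ENNReal.ofReal (1 - Real.log a)
  else 1

theorem modelSize_one (κ : ℝ) : modelSize κ 1 = 1 := by
  simp [modelSize]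

theorem modelIntegral_zero {β γ κ : ℝ} (hκ : κ = γ + 1 - β) (h : κ ≤ 0) :
    modelIntegral β γ 0 = ∞ := by
  by_contra hfin
  have e : ∀ r ∈ Ioo (0 : ℝ) 1, ENNReal.ofReal ((0 + r) ^ (-β) * r ^ γ) =
      ENNReal.ofReal (r ^ (κ - 1)) := fun r hr => by
    rw [zero_add, ← Real.rpow_add hr.1, hκ]; ring_nf
  have h1 : IntegrableOn (fun r : ℝ => r ^ (κ - 1)) (Ioo 0 1) := by
    refine ⟨by fun_prop, ?_⟩
    rw [hasFiniteIntegral_iff_ofReal, ← setLIntegral_congr_fun measurableSet_Ioo e]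
    · exact lt_top_iff_ne_top.mpr hfin
    · exact (ae_restrict_iff' measurableSet_Ioo).mpr
        (Filter.Eventually.of_forall fun r hr => Real.rpow_nonneg hr.1.le _)
  rw [intervalIntegral.integrableOn_Ioo_rpow_iff one_pos] at h1
  linarith

/-- Below `a` the sum `a + r` is comparable to `a`, above it to `r`; each piece is then the integral
of a pure power. -/
theorem modelIntegral_split {β γ a : ℝ} (ha : 0 < a) (ha1 : a ≤ 1) :
    modelIntegral β γ a = (∫⁻ r in Ioo (0 : ℝ) a, ENNReal.ofReal ((a + r) ^ (-β) * r ^ γ)) +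
      ∫⁻ r in Ico a 1, ENNReal.ofReal ((a + r) ^ (-β) * r ^ γ) := by
  rw [modelIntegral, ← Ioo_union_Ico_eq_Ioo ha ha1, lintegral_union measurableSet_Ico]
  rw [Set.disjoint_left]
  exact fun r h1 h2 => absurd h1.2 (not_lt.mpr h2.1)

theorem lintegral_Ioo_model_le {β γ a : ℝ} (hβ : 0 < β) (hγ : -1 < γ) (ha : 0 < a) :
    ∫⁻ r in Ioo (0 : ℝ) a, ENNReal.ofReal ((a + r) ^ (-β) * r ^ γ) ≤
      ENNReal.ofReal (a ^ (γ + 1 - β) / (γ + 1)) := by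
  calc _ ≤ ∫⁻ r in Ioo (0 : ℝ) a, ENNReal.ofReal (a ^ (-β)) * ENNReal.ofReal (r ^ γ) := by
        refine setLIntegral_mono' measurableSet_Ioo fun r hr => ?_
        rw [← ENNReal.ofReal_mul (by positivity)]
        refine ENNReal.ofReal_le_ofReal (mul_le_mul_of_nonneg_right ?_ (Real.rpow_nonneg hr.1.le _))
        exact Real.rpow_le_rpow_of_nonpos ha (by linarith [hr.1]) (by linarith)
    _ = _ := by
        rw [lintegral_const_mul _ (by fun_prop), lintegral_Ioo_rpow hγ ha.le,
          ← ENNReal.ofReal_mul (by positivity), ← mul_div_assoc, ← Real.rpow_add ha]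
        ring_nf

theorem le_lintegral_Ioo_model {β γ a : ℝ} (hβ : 0 < β) (hγ : -1 < γ) (ha : 0 < a) :
    ENNReal.ofReal (2 ^ (-β) * (a ^ (γ + 1 - β) / (γ + 1))) ≤
      ∫⁻ r in Ioo (0 : ℝ) a, ENNReal.ofReal ((a + r) ^ (-β) * r ^ γ) := by
  calc _ = ∫⁻ r in Ioo (0 : ℝ) a, ENNReal.ofReal ((2 * a) ^ (-β)) * ENNReal.ofReal (r ^ γ) := by
        rw [lintegral_const_mul _ (by fun_prop), lintegral_Ioo_rpow hγ ha.le,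
          ← ENNReal.ofReal_mul (by positivity), Real.mul_rpow (by norm_num) ha.le,
          show γ + 1 - β = -β + (γ + 1) by ring, Real.rpow_add ha]
        ring_nf
    _ ≤ _ := by
        refine setLIntegral_mono' measurableSet_Ioo fun r hr => ?_
        rw [← ENNReal.ofReal_mul (by positivity)]
        refine ENNReal.ofReal_le_ofReal (mul_le_mul_of_nonneg_right ?_ (Real.rpow_nonneg hr.1.le _))
        exact Real.rpow_le_rpow_of_nonpos (by linarith [hr.1]) (by linarith [hr.2]) (by linarith)

theorem model_integrand_le {β γ a r : ℝ} (hβ : 0 < β) (ha : 0 ≤ a) (hr : 0 < r) :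
    (a + r) ^ (-β) * r ^ γ ≤ r ^ (γ + 1 - β - 1) := by
  rw [show γ + 1 - β - 1 = -β + γ by ring, Real.rpow_add hr]
  exact mul_le_mul_of_nonneg_right (Real.rpow_le_rpow_of_nonpos hr (by linarith) (by linarith))
    (Real.rpow_nonneg hr.le _)

/-- The size of the model integral. -/
theorem comparableOn_modelIntegral {β γ κ : ℝ} (hβ : 0 < β) (hγ : -1 < γ) (hκ : κ = γ + 1 - β) :
    ComparableOn (modelIntegral β γ) (modelSize κ) (Icc 0 1) := by
  have hγ' : 0 < γ + 1 := by linarith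
  rcases lt_trichotomy κ 0 with h | h | h
  -- For κ < 0 both pieces are at most a multiple of `a ^ κ`, and the piece below `a` alone gives
  -- the lower bound.
  · refine ⟨2 ^ (-β) / (γ + 1), 1 / (γ + 1) + 1 / (-κ), by positivity, ?_, fun a ha => ?_⟩
    · have : 0 < -κ := by linarith
      positivity
    rcases ha.1.eq_or_lt with rfl | ha0
    · rw [modelIntegral_zero hκ h.le, modelSize, if_pos h, ENNReal.ofReal_zero,
        ENNReal.zero_rpow_of_neg h]
      refine ⟨le_top, ?_⟩
      have : 0 < -κ := by linarith
      rw [ENNReal.mul_top (by rw [ne_eq, ENNReal.ofReal_eq_zero, not_le]; positivity)]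
    · have hκ' : 0 < -κ := by linarith
      rw [modelSize, if_pos h, ENNReal.ofReal_rpow_of_pos ha0, ← ENNReal.ofReal_mul (by positivity),
        ← ENNReal.ofReal_mul (by positivity), modelIntegral_split ha0 ha.2]
      constructor
      · refine le_trans (le_of_eq ?_) ((le_lintegral_Ioo_model hβ hγ ha0).trans le_self_add)
        rw [← hκ]; congr 1; ring
      · rw [add_mul, ENNReal.ofReal_add (by positivity) (by positivity)]
        refine add_le_add ((lintegral_Ioo_model_le hβ hγ ha0).trans (le_of_eq ?_)) ?_
        · rw [← hκ]; congr 1; ring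
        · calc _ ≤ ∫⁻ r in Ico a 1, ENNReal.ofReal (r ^ (κ - 1)) := by
                refine setLIntegral_mono' measurableSet_Ico fun r hr => ?_
                rw [hκ]
                exact ENNReal.ofReal_le_ofReal
                  (model_integrand_le hβ ha.1 (lt_of_lt_of_le ha0 hr.1))
            _ ≤ _ := by
                rw [lintegral_Ico_rpow h.ne ha0 ha.2]
                refine ENNReal.ofReal_le_ofReal ?_
                rw [← neg_div_neg_eq, one_div_mul_eq_div]
                gcongr
                linarith
  -- For κ = 0 the piece below `a` has constant size, the 1 in `1 - Real.log a`, and the piece above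
  -- gives the logarithm.
  · refine ⟨2 ^ (-β) * min (1 / (γ + 1)) 1, max (1 / (γ + 1)) 1, by positivity, by positivity,
      fun a ha => ?_⟩
    have hsize : ∀ b, modelSize κ b = if b = 0 then ∞ else ENNReal.ofReal (1 - Real.log b) := by
      intro b; rw [modelSize, if_neg (by linarith), if_pos h]
    rcases ha.1.eq_or_lt with rfl | ha0
    · rw [modelIntegral_zero hκ h.le, hsize, if_pos rfl]
      refine ⟨le_top, ?_⟩
      rw [ENNReal.mul_top (by rw [ne_eq, ENNReal.ofReal_eq_zero, not_le]; positivity)]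
    · have hlog : 0 ≤ -Real.log a := by linarith [Real.log_nonpos ha.1 ha.2]
      have hpow : a ^ (γ + 1 - β) = 1 := by rw [← hκ, h, Real.rpow_zero]
      rw [hsize, if_neg ha0.ne', ← ENNReal.ofReal_mul (by positivity),
        ← ENNReal.ofReal_mul (by positivity), modelIntegral_split ha0 ha.2]
      constructor
      · have h2 : ENNReal.ofReal (2 ^ (-β) * (-Real.log a)) ≤
            ∫⁻ r in Ico a 1, ENNReal.ofReal ((a + r) ^ (-β) * r ^ γ) := by
          rw [ENNReal.ofReal_mul (by positivity), ← lintegral_Ico_inv ha0 ha.2,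
            ← lintegral_const_mul _ (by fun_prop)]
          refine setLIntegral_mono' measurableSet_Ico fun r hr => ?_
          have hr0 : 0 < r := lt_of_lt_of_le ha0 hr.1
          rw [← ENNReal.ofReal_mul (by positivity), show (-1 : ℝ) = -β + γ by linarith,
            Real.rpow_add hr0, ← mul_assoc, ← Real.mul_rpow (by norm_num) hr0.le]
          refine ENNReal.ofReal_le_ofReal (mul_le_mul_of_nonneg_right ?_ (by positivity))
          exact Real.rpow_le_rpow_of_nonpos (by linarith) (by linarith [hr.1]) (by linarith)
        refine le_trans ?_ (add_le_add (le_lintegral_Ioo_model hβ hγ ha0) h2)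
        rw [hpow, ← ENNReal.ofReal_add (by positivity) (by positivity), ← mul_add, mul_assoc]
        refine ENNReal.ofReal_le_ofReal (mul_le_mul_of_nonneg_left ?_ (by positivity))
        have h3 := min_le_left (1 / (γ + 1)) 1
        have h4 := mul_le_mul_of_nonneg_right (min_le_right (1 / (γ + 1)) 1) hlog
        linarith
      · calc _ ≤ ENNReal.ofReal (1 / (γ + 1)) + ENNReal.ofReal (-Real.log a) := by
              refine add_le_add ?_ ?_
              · exact (lintegral_Ioo_model_le hβ hγ ha0).trans (le_of_eq (by rw [hpow]))
              · rw [← lintegral_Ico_inv ha0 ha.2]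
                refine setLIntegral_mono' measurableSet_Ico fun r hr => ?_
                rw [show (-1 : ℝ) = γ + 1 - β - 1 by linarith]
                exact ENNReal.ofReal_le_ofReal
                  (model_integrand_le hβ ha.1 (lt_of_lt_of_le ha0 hr.1))
          _ ≤ _ := by
              rw [← ENNReal.ofReal_add (by positivity) hlog]
              refine ENNReal.ofReal_le_ofReal ?_
              have h3 := le_max_left (1 / (γ + 1)) 1
              have h4 := mul_le_mul_of_nonneg_right (le_max_right (1 / (γ + 1)) 1) hlog
              linarith
  -- For κ > 0 the integral converges even at `a = 0`; `r ≤ a + r ≤ 2` gives both bounds.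
  · refine ⟨2 ^ (-β) / (γ + 1), 1 / κ, by positivity, by positivity, fun a ha => ?_⟩
    rw [modelSize, if_neg (by linarith), if_neg h.ne', mul_one, mul_one]
    constructor
    · calc _ = ∫⁻ r in Ioo (0 : ℝ) 1, ENNReal.ofReal (2 ^ (-β)) * ENNReal.ofReal (r ^ γ) := by
            rw [lintegral_const_mul _ (by fun_prop), lintegral_Ioo_rpow hγ zero_le_one,
              ← ENNReal.ofReal_mul (by positivity), Real.one_rpow, mul_one_div]
        _ ≤ _ := by
            refine setLIntegral_mono' measurableSet_Ioo fun r hr => ?_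
            rw [← ENNReal.ofReal_mul (by positivity)]
            refine ENNReal.ofReal_le_ofReal
              (mul_le_mul_of_nonneg_right ?_ (Real.rpow_nonneg hr.1.le _))
            exact Real.rpow_le_rpow_of_nonpos (by linarith [hr.1, ha.1])
              (by linarith [hr.2, ha.2]) (by linarith)
    · calc _ ≤ ∫⁻ r in Ioo (0 : ℝ) 1, ENNReal.ofReal (r ^ (κ - 1)) := by
            refine setLIntegral_mono' measurableSet_Ioo fun r hr => ?_
            rw [hκ]
            exact ENNReal.ofReal_le_ofReal (model_integrand_le hβ ha.1 hr.1)
        _ = _ := by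
            rw [lintegral_Ioo_rpow (by linarith) zero_le_one, Real.one_rpow, sub_add_cancel]

/-! ### The Riesz integral according to the sign of xy. -/

theorem lintegral_Ioo_one_sub (f : ℝ → ℝ≥0∞) :
    ∫⁻ s in Ioo (0 : ℝ) 1, f (1 - s) = ∫⁻ s in Ioo (0 : ℝ) 1, f s := by
  have h := (Measure.measurePreserving_sub_left (volume : Measure ℝ) 1).setLIntegral_comp_preimage_emb
    (Homeomorph.subLeft (1 : ℝ)).measurableEmbedding f (Ioo 0 1)
  rw [← h]
  congr 2
  ext s
  simp only [mem_Ioo, mem_preimage]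
  constructor <;> rintro ⟨h1, h2⟩ <;> constructor <;> linarith

theorem quadratic_pos {x y s : ℝ} (hxy : 0 < |x| + |y|) (hs : |s| < 1) :
    0 < x ^ 2 + y ^ 2 - 2 * x * y * s := by
  have h := abs_lt.mp hs
  have hpos : 0 < x ^ 2 + y ^ 2 := by
    nlinarith [sq_abs x, sq_abs y, abs_nonneg x, abs_nonneg y, sq_nonneg (|x| - |y|),
      mul_pos hxy hxy]
  rcases le_total 0 (x * y) with h1 | h1
  · nlinarith [sq_nonneg (x - y)]
  · nlinarith [sq_nonneg (x + y)]

/-- The integral over Poisson's measure of the pair of powers whose superposition is the Riesz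
kernel. -/
def rieszIntegral (α β : ℝ) (q : ℝ × ℝ) : ℝ≥0∞ :=
  ∫⁻ s, (ENNReal.ofReal (1 + s) *
      ENNReal.ofReal (q.1 ^ 2 + q.2 ^ 2 - 2 * q.1 * q.2 * s) ^ (-β) +
    ENNReal.ofReal (1 - s) *
      ENNReal.ofReal (q.1 ^ 2 + q.2 ^ 2 + 2 * q.1 * q.2 * s) ^ (-β)) ∂(poissonMeasure α)

theorem rieszIntegral_eq {α : ℝ} (hα : -1 / 2 < α) (β : ℝ) {q : ℝ × ℝ} (hq : 0 < |q.1| + |q.2|) :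
    rieszIntegral α β q = ENNReal.ofReal (√Real.pi * Real.Gamma (α + 1 / 2))⁻¹ *
      ∫⁻ s in Ioo (0 : ℝ) 1, ENNReal.ofReal ((1 - s ^ 2) ^ (α - 1 / 2) *
        ((1 + s) * (q.1 ^ 2 + q.2 ^ 2 - 2 * q.1 * q.2 * s) ^ (-β) +
          (1 - s) * (q.1 ^ 2 + q.2 ^ 2 + 2 * q.1 * q.2 * s) ^ (-β))) := by
  have hG := Real.Gamma_pos_of_pos (show 0 < α + 1 / 2 by linarith)
  rw [rieszIntegral, poissonMeasure, lintegral_withDensity_eq_lintegral_mul _ (by fun_prop)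
    (by fun_prop), ← lintegral_const_mul _ (by fun_prop)]
  refine setLIntegral_congr_fun measurableSet_Ioo fun s hs => ?_
  have h1 : 0 < 1 + s := by linarith [hs.1]
  have h2 : 0 < 1 - s := by linarith [hs.2]
  have h3 : 0 < 1 - s ^ 2 := by nlinarith
  have h4 := quadratic_pos hq (by rw [abs_of_pos hs.1]; exact hs.2 : |s| < 1)
  have h5 := quadratic_pos hq (by rw [abs_neg, abs_of_pos hs.1]; exact hs.2 : |-s| < 1)
  rw [mul_neg, sub_neg_eq_add] at h5
  simp only [Pi.mul_apply]
  rw [ENNReal.ofReal_rpow_of_pos h4, ENNReal.ofReal_rpow_of_pos h5,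
    ← ENNReal.ofReal_mul h1.le, ← ENNReal.ofReal_mul h2.le,
    ← ENNReal.ofReal_add (by positivity) (by positivity), ← ENNReal.ofReal_mul (by positivity),
    ← ENNReal.ofReal_mul (by positivity)]
  congr 1
  rw [show α + 1 / 2 - 1 = α - 1 / 2 by ring]
  ring

theorem rpow_one_sub_sq_bounds {s γ : ℝ} (h0 : 0 < s) (h1 : s < 1) :
    2 ^ (-|γ|) * (1 - s) ^ γ ≤ (1 - s ^ 2) ^ γ ∧ (1 - s ^ 2) ^ γ ≤ 2 ^ |γ| * (1 - s) ^ γ := by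
  have hs : 0 < 1 - s := by linarith
  rw [show 1 - s ^ 2 = (1 + s) * (1 - s) by ring, Real.mul_rpow (by linarith) hs.le]
  have h2 : (1 + s) ^ γ ≤ (1 + s) ^ |γ| :=
    Real.rpow_le_rpow_of_exponent_le (by linarith) (le_abs_self γ)
  have h3 : (1 + s) ^ |γ| ≤ 2 ^ |γ| :=
    Real.rpow_le_rpow (by linarith) (by linarith) (abs_nonneg γ)
  have h4 : (1 + s) ^ (-|γ|) ≤ (1 + s) ^ γ :=
    Real.rpow_le_rpow_of_exponent_le (by linarith) (neg_abs_le γ)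
  have h5 : (2 : ℝ) ^ (-|γ|) ≤ (1 + s) ^ (-|γ|) :=
    Real.rpow_le_rpow_of_nonpos (by linarith) (by linarith) (by linarith [abs_nonneg γ])
  have h6 : 0 ≤ (1 - s) ^ γ := by positivity
  exact ⟨mul_le_mul_of_nonneg_right (h5.trans h4) h6, mul_le_mul_of_nonneg_right (h2.trans h3) h6⟩

/-- Here |x|+|y| = |x+y|, and the first quadratic (x-y)² + 2xy(1-s) is compared with (x-y)² +
(x+y)²(1-s) = p²(a+1-s). The second quadratic is at least the first, so its term is absorbed. -/
theorem rieszIntegral_comparableOn_of_mul_nonneg {α β : ℝ} (hα : -1 / 2 < α) (hβ : 0 < β) :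
    ComparableOn (rieszIntegral α β)
      (fun q => ENNReal.ofReal (((|q.1| + |q.2|) ^ 2) ^ (-β)) *
        modelIntegral β (α - 1 / 2) ((|q.1 - q.2| / (|q.1| + |q.2|)) ^ 2))
      {q | 0 < |q.1| + |q.2| ∧ 0 ≤ q.1 * q.2} := by
  have hG := Real.Gamma_pos_of_pos (show 0 < α + 1 / 2 by linarith)
  refine (ComparableOn.of_eq fun q hq => rieszIntegral_eq hα β hq.1).trans
    ((ComparableOn.const_mul (by positivity) _ _).trans ?_)
  set γ := α - 1 / 2
  -- The 2 is (1+s)+(1-s), the powers of 2 replace 1-s² by 1-s, and 3 is the loss in the lower bound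
  -- for the quadratic.
  refine ⟨2 ^ (-|γ|), 2 * 2 ^ |γ| * 3 ^ β, by positivity, by positivity, ?_⟩
  rintro ⟨x, y⟩ ⟨hp, hxy⟩
  simp only at hp hxy ⊢
  set p := |x| + |y| with hpdef
  set a := (|x - y| / p) ^ 2 with ha
  have hpa : p ^ 2 * a = (x - y) ^ 2 := by
    rw [ha, div_pow, sq_abs]; field_simp
  have hp2 : p ^ 2 = (x + y) ^ 2 := by
    rw [hpdef, add_sq, sq_abs, sq_abs, mul_assoc, ← abs_mul, abs_of_nonneg hxy]; ring
  have ha0 : 0 ≤ a := by positivity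
  have key : ∀ s ∈ Ioo (0 : ℝ) 1,
      2 ^ (-|γ|) * (p ^ 2) ^ (-β) * ((a + (1 - s)) ^ (-β) * (1 - s) ^ γ) ≤ (1 - s ^ 2) ^ γ *
        ((1 + s) * (x ^ 2 + y ^ 2 - 2 * x * y * s) ^ (-β) +
          (1 - s) * (x ^ 2 + y ^ 2 + 2 * x * y * s) ^ (-β)) ∧
      (1 - s ^ 2) ^ γ *
        ((1 + s) * (x ^ 2 + y ^ 2 - 2 * x * y * s) ^ (-β) +
          (1 - s) * (x ^ 2 + y ^ 2 + 2 * x * y * s) ^ (-β)) ≤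
      2 * 2 ^ |γ| * 3 ^ β * (p ^ 2) ^ (-β) * ((a + (1 - s)) ^ (-β) * (1 - s) ^ γ) := by
    intro s hs
    have h1 : 0 < 1 + s := by linarith [hs.1]
    have h2 : 0 < 1 - s := by linarith [hs.2]
    have h4 := quadratic_pos (x := x) (y := y) hp
      (by rw [abs_of_pos hs.1]; exact hs.2 : |s| < 1)
    have h5 : x ^ 2 + y ^ 2 - 2 * x * y * s ≤ x ^ 2 + y ^ 2 + 2 * x * y * s := by
      nlinarith [mul_nonneg hxy hs.1.le]
    obtain ⟨hw1, hw2⟩ := rpow_one_sub_sq_bounds (γ := γ) hs.1 hs.2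
    have hw : 0 ≤ (1 - s) ^ γ := by positivity
    have hY : 0 ≤ (x ^ 2 + y ^ 2 + 2 * x * y * s) ^ (-β) := Real.rpow_nonneg (h4.le.trans h5) _
    have hYX := Real.rpow_le_rpow_of_nonpos h4 h5 (neg_nonpos.mpr hβ.le)
    have hup : x ^ 2 + y ^ 2 - 2 * x * y * s ≤ p ^ 2 * (a + (1 - s)) := by
      rw [mul_add, hpa, hp2]
      nlinarith [mul_nonneg (add_nonneg (sq_nonneg x) (sq_nonneg y)) h2.le]
    have hlo : p ^ 2 * (a + (1 - s)) / 3 ≤ x ^ 2 + y ^ 2 - 2 * x * y * s := by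
      rw [mul_add, hpa, hp2]
      nlinarith [mul_nonneg hxy h2.le, mul_nonneg (sq_nonneg (x - y)) hs.1.le, sq_nonneg (x - y)]
    have hX1 := Real.rpow_le_rpow_of_nonpos h4 hup (neg_nonpos.mpr hβ.le)
    have hX2 := Real.rpow_le_rpow_of_nonpos (by positivity) hlo (neg_nonpos.mpr hβ.le)
    rw [Real.div_rpow (by positivity) (by norm_num), Real.rpow_neg (by norm_num : (0 : ℝ) ≤ 3),
      div_inv_eq_mul] at hX2
    rw [Real.mul_rpow (by positivity) (by positivity)] at hX1 hX2
    set X := (x ^ 2 + y ^ 2 - 2 * x * y * s) ^ (-β)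
    set Y := (x ^ 2 + y ^ 2 + 2 * x * y * s) ^ (-β)
    have hX : 0 ≤ X := hY.trans hYX
    have hww : 0 ≤ (1 - s ^ 2) ^ γ := (by positivity : (0 : ℝ) ≤ _).trans hw1
    constructor
    · calc _ = 2 ^ (-|γ|) * (1 - s) ^ γ * ((p ^ 2) ^ (-β) * (a + (1 - s)) ^ (-β)) := by ring
        _ ≤ (1 - s ^ 2) ^ γ * X := mul_le_mul hw1 hX1 (by positivity) hww
        _ ≤ _ := by
          refine mul_le_mul_of_nonneg_left ?_ hww
          linarith [mul_nonneg hs.1.le hX, mul_nonneg h2.le hY]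
    · calc _ ≤ (1 - s ^ 2) ^ γ * (2 * X) := by
            refine mul_le_mul_of_nonneg_left ?_ hww
            linarith [mul_le_mul_of_nonneg_left hYX h2.le]
        _ ≤ 2 ^ |γ| * (1 - s) ^ γ * (2 * ((p ^ 2) ^ (-β) * (a + (1 - s)) ^ (-β) * 3 ^ β)) := by
          gcongr
        _ = _ := by ring
  rw [modelIntegral, ← lintegral_Ioo_one_sub, ← mul_assoc, ← mul_assoc,
    ← ENNReal.ofReal_mul (by positivity), ← ENNReal.ofReal_mul (by positivity),
    ← lintegral_const_mul _ (by fun_prop), ← lintegral_const_mul _ (by fun_prop)]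
  constructor
  · refine setLIntegral_mono' measurableSet_Ioo fun s hs => ?_
    rw [← ENNReal.ofReal_mul (by positivity)]
    exact ENNReal.ofReal_le_ofReal (key s hs).1
  · refine setLIntegral_mono' measurableSet_Ioo fun s hs => ?_
    rw [← ENNReal.ofReal_mul (by positivity)]
    exact ENNReal.ofReal_le_ofReal (key s hs).2

/-- Here |x|+|y| = |x-y|, and the first quadratic lies between p²/2 and p². The second may tend to 0
as s → 1, but it is at least p²(1-s)/3 and its weight 1-s compensates: the exponent γ+1-β of 1-s
exceeds -1 because β < α+1. -/
theorem rieszIntegral_comparableOn_of_mul_neg {α β : ℝ} (hα : -1 / 2 < α) (hβ : 0 < β)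
    (hβα : β < α + 1) :
    ComparableOn (rieszIntegral α β) (fun q => ENNReal.ofReal (((|q.1| + |q.2|) ^ 2) ^ (-β)))
      {q | q.1 * q.2 < 0} := by
  have hG := Real.Gamma_pos_of_pos (show 0 < α + 1 / 2 by linarith)
  have hpos : ∀ q ∈ {q : ℝ × ℝ | q.1 * q.2 < 0}, 0 < |q.1| + |q.2| := fun q hq => by
    have : q.1 ≠ 0 := fun h => by simp [h] at hq
    have := abs_pos.mpr this
    positivity
  refine (ComparableOn.of_eq fun q hq => rieszIntegral_eq hα β (hpos q hq)).trans
    ((ComparableOn.const_mul (by positivity) _ _).trans ?_)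
  set γ := α - 1 / 2 with hγ
  have hγ1 : 0 < γ + 1 := by linarith
  have hδ : 0 < γ + 1 - β + 1 := by linarith
  refine ⟨2 ^ (-|γ|) * (1 / (γ + 1)),
    2 ^ |γ| * (2 * 2 ^ β * (1 / (γ + 1)) + 3 ^ β * (1 / (γ + 1 - β + 1))),
    by positivity, by positivity, ?_⟩
  rintro ⟨x, y⟩ hxy
  have hp := hpos _ hxy
  simp only [mem_ofPred_eq] at hp hxy ⊢
  set p := |x| + |y| with hpdef
  have hp2 : p ^ 2 = (x - y) ^ 2 := by
    rw [hpdef, add_sq, sq_abs, sq_abs, mul_assoc, ← abs_mul, abs_of_neg hxy]; ring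
  have key : ∀ s ∈ Ioo (0 : ℝ) 1,
      2 ^ (-|γ|) * (p ^ 2) ^ (-β) * (1 - s) ^ γ ≤ (1 - s ^ 2) ^ γ *
        ((1 + s) * (x ^ 2 + y ^ 2 - 2 * x * y * s) ^ (-β) +
          (1 - s) * (x ^ 2 + y ^ 2 + 2 * x * y * s) ^ (-β)) ∧
      (1 - s ^ 2) ^ γ *
        ((1 + s) * (x ^ 2 + y ^ 2 - 2 * x * y * s) ^ (-β) +
          (1 - s) * (x ^ 2 + y ^ 2 + 2 * x * y * s) ^ (-β)) ≤
      2 ^ |γ| * (p ^ 2) ^ (-β) * (2 * 2 ^ β) * (1 - s) ^ γ +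
        2 ^ |γ| * (p ^ 2) ^ (-β) * 3 ^ β * (1 - s) ^ (γ + 1 - β) := by
    intro s hs
    have h1 : 0 < 1 + s := by linarith [hs.1]
    have h2 : 0 < 1 - s := by linarith [hs.2]
    have h4 := quadratic_pos (x := x) (y := y) hp
      (by rw [abs_of_pos hs.1]; exact hs.2 : |s| < 1)
    have hxs : x * y * s ≤ 0 := mul_nonpos_of_nonpos_of_nonneg hxy.le hs.1.le
    have hxs' : x * y * (1 - s) ≤ 0 := mul_nonpos_of_nonpos_of_nonneg hxy.le h2.le
    obtain ⟨hw1, hw2⟩ := rpow_one_sub_sq_bounds (γ := γ) hs.1 hs.2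
    have hw : 0 ≤ (1 - s) ^ γ := by positivity
    have hww : 0 ≤ (1 - s ^ 2) ^ γ := (by positivity : (0 : ℝ) ≤ _).trans hw1
    have hXu : x ^ 2 + y ^ 2 - 2 * x * y * s ≤ p ^ 2 := by rw [hp2]; nlinarith
    have hXl : p ^ 2 / 2 ≤ x ^ 2 + y ^ 2 - 2 * x * y * s := by
      rw [hp2]; nlinarith [sq_nonneg (x + y)]
    have hYl : p ^ 2 * (1 - s) / 3 ≤ x ^ 2 + y ^ 2 + 2 * x * y * s := by
      rw [hp2]; nlinarith [mul_nonneg (sq_nonneg (x + y)) h2.le, mul_nonneg (sq_nonneg (x + y)) hs.1.le]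
    have hX1 := Real.rpow_le_rpow_of_nonpos h4 hXu (neg_nonpos.mpr hβ.le)
    have hX2 := Real.rpow_le_rpow_of_nonpos (by positivity) hXl (neg_nonpos.mpr hβ.le)
    have hY2 := Real.rpow_le_rpow_of_nonpos (by positivity) hYl (neg_nonpos.mpr hβ.le)
    have hY : 0 ≤ (x ^ 2 + y ^ 2 + 2 * x * y * s) ^ (-β) :=
      Real.rpow_nonneg ((by positivity : (0 : ℝ) ≤ _).trans hYl) _
    rw [Real.div_rpow (by positivity) (by norm_num), Real.rpow_neg (by norm_num : (0 : ℝ) ≤ 2),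
      div_inv_eq_mul] at hX2
    rw [Real.div_rpow (by positivity) (by norm_num), Real.rpow_neg (by norm_num : (0 : ℝ) ≤ 3),
      div_inv_eq_mul, Real.mul_rpow (by positivity) h2.le] at hY2
    have hr : (1 - s) ^ (γ + 1 - β) = (1 - s) ^ γ * ((1 - s) * (1 - s) ^ (-β)) := by
      rw [show γ + 1 - β = γ + (1 + -β) by ring, Real.rpow_add h2, Real.rpow_add h2, Real.rpow_one]
    set X := (x ^ 2 + y ^ 2 - 2 * x * y * s) ^ (-β)
    set Y := (x ^ 2 + y ^ 2 + 2 * x * y * s) ^ (-β)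
    set P := (p ^ 2) ^ (-β) with hP
    have hP0 : 0 ≤ P := by positivity
    have hX : 0 ≤ X := hP0.trans hX1
    constructor
    · calc _ = 2 ^ (-|γ|) * (1 - s) ^ γ * P := by ring
        _ ≤ (1 - s ^ 2) ^ γ * X := mul_le_mul hw1 hX1 hP0 hww
        _ ≤ _ := by
          refine mul_le_mul_of_nonneg_left ?_ hww
          nlinarith [mul_nonneg hs.1.le hX, mul_nonneg h2.le hY]
    · calc _ ≤ (1 - s ^ 2) ^ γ * (2 * (P * 2 ^ β) + (1 - s) * (P * (1 - s) ^ (-β) * 3 ^ β)) := by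
            refine mul_le_mul_of_nonneg_left (add_le_add ?_ ?_) hww
            · exact mul_le_mul (by linarith [hs.2]) hX2 hX (by norm_num)
            · exact mul_le_mul_of_nonneg_left hY2 h2.le
        _ ≤ 2 ^ |γ| * (1 - s) ^ γ *
            (2 * (P * 2 ^ β) + (1 - s) * (P * (1 - s) ^ (-β) * 3 ^ β)) := by
          gcongr
        _ = _ := by rw [hr]; ring
  have hint : ∀ δ : ℝ, 0 < δ + 1 → ∫⁻ s in Ioo (0 : ℝ) 1, ENNReal.ofReal ((1 - s) ^ δ) =
      ENNReal.ofReal (1 / (δ + 1)) := fun δ hδ => by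
    rw [lintegral_Ioo_one_sub (fun r => ENNReal.ofReal (r ^ δ)),
      lintegral_Ioo_rpow (by linarith) zero_le_one, Real.one_rpow]
  constructor
  · calc _ = ∫⁻ s in Ioo (0 : ℝ) 1, ENNReal.ofReal (2 ^ (-|γ|) * (p ^ 2) ^ (-β)) *
          ENNReal.ofReal ((1 - s) ^ γ) := by
          rw [lintegral_const_mul _ (by fun_prop), hint γ hγ1, ← ENNReal.ofReal_mul (by positivity),
            ← ENNReal.ofReal_mul (by positivity)]
          congr 1; ring
      _ ≤ _ := by
          refine setLIntegral_mono' measurableSet_Ioo fun s hs => ?_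
          rw [← ENNReal.ofReal_mul (by positivity)]
          exact ENNReal.ofReal_le_ofReal (key s hs).1
  · calc _ ≤ ∫⁻ s in Ioo (0 : ℝ) 1,
          (ENNReal.ofReal (2 ^ |γ| * (p ^ 2) ^ (-β) * (2 * 2 ^ β)) *
            ENNReal.ofReal ((1 - s) ^ γ) +
          ENNReal.ofReal (2 ^ |γ| * (p ^ 2) ^ (-β) * 3 ^ β) *
            ENNReal.ofReal ((1 - s) ^ (γ + 1 - β))) := by
          refine setLIntegral_mono' measurableSet_Ioo fun s hs => ?_
          have h2 : 0 < 1 - s := by linarith [hs.2]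
          rw [← ENNReal.ofReal_mul (by positivity), ← ENNReal.ofReal_mul (by positivity),
            ← ENNReal.ofReal_add (by positivity) (by positivity)]
          exact ENNReal.ofReal_le_ofReal (key s hs).2
      _ = _ := by
          rw [lintegral_add_left (by fun_prop), lintegral_const_mul _ (by fun_prop),
            lintegral_const_mul _ (by fun_prop), hint γ hγ1, hint _ hδ,
            ← ENNReal.ofReal_mul (by positivity), ← ENNReal.ofReal_mul (by positivity),
            ← ENNReal.ofReal_mul (by positivity),
            ← ENNReal.ofReal_add (by positivity) (by positivity)]
          congr 1; ring

/-! ### Comparison with the sharp bound, and the endpoint α = -1/2. -/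

theorem sharpBound_comparableOn {α σ β : ℝ} (hβ : β = α + 1 - σ) :
    ComparableOn (fun q : ℝ × ℝ => sharpBound α σ q.1 q.2)
      (fun q => ENNReal.ofReal (((|q.1| + |q.2|) ^ 2) ^ (-β)) *
        modelSize (σ - 1 / 2) ((|q.1 - q.2| / (|q.1| + |q.2|)) ^ 2))
      {q | 0 < |q.1| + |q.2|} := by
  -- Off σ = 1/2 the two sides agree. At σ = 1/2, with L = log(p/|x-y|) ≥ 0, one compares log 2 + L
  -- with 1 + 2L, and 1/2 < log 2 < 1 yields these constants.
  refine ⟨1 / 2, 1, by norm_num, one_pos, ?_⟩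
  rintro ⟨x, y⟩ hp
  simp only [mem_ofPred_eq] at hp ⊢
  have hne : ¬(x = 0 ∧ y = 0) := by
    rintro ⟨rfl, rfl⟩; simp at hp
  have hqp : |x - y| ≤ |x| + |y| := abs_sub x y
  have hq0 : |x - y| = 0 ↔ x = y := by rw [abs_eq_zero, sub_eq_zero]
  rw [sharpBound, if_neg hne, ENNReal.ofReal_one, one_mul]
  set p := |x| + |y|
  set q := |x - y|
  have hq : 0 ≤ q := abs_nonneg _
  have half : ∀ v : ℝ≥0∞, ENNReal.ofReal (1 / 2) * v ≤ v := fun v =>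
    mul_le_of_le_one_left' (ENNReal.ofReal_le_one.mpr (by norm_num))
  have hP : (p ^ 2) ^ (-β) = p ^ (-2 * β) := by
    rw [← Real.rpow_two, ← Real.rpow_mul hp.le]; ring_nf
  have hP0 : 0 < p ^ (-2 * β) := by positivity
  have hEq : ∀ {u v : ℝ≥0∞}, u = v → ENNReal.ofReal (1 / 2) * v ≤ u ∧ u ≤ v := fun h =>
    ⟨h ▸ half _, h.le⟩
  rcases lt_trichotomy σ (1 / 2) with h | h | h
  · rw [if_pos h, modelSize, if_pos (by linarith)]
    refine hEq ?_
    rcases hq.eq_or_lt with hq1 | hq1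
    · rw [← hq1, zero_div, zero_pow two_ne_zero, ENNReal.ofReal_zero,
        ENNReal.zero_rpow_of_neg (by linarith), ENNReal.zero_rpow_of_neg (by linarith), hP,
        ENNReal.ofReal_rpow_of_pos hp, ENNReal.mul_top, ENNReal.mul_top]
      · rw [ne_eq, ENNReal.ofReal_eq_zero, not_le]; exact hP0
      · rw [ne_eq, ENNReal.ofReal_eq_zero, not_le]; positivity
    · rw [ENNReal.ofReal_rpow_of_pos hp, ENNReal.ofReal_rpow_of_pos hq1,
        ENNReal.ofReal_rpow_of_pos (by positivity), ← ENNReal.ofReal_mul (by positivity),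
        ← ENNReal.ofReal_mul (by positivity), hP]
      congr 1
      rw [← Real.rpow_two, ← Real.rpow_mul (by positivity), Real.div_rpow hq hp.le, div_eq_mul_inv,
        ← Real.rpow_neg hp.le, mul_left_comm, ← Real.rpow_add hp, mul_comm]
      congr 2
      · ring
      · rw [hβ]; ring
  · rw [if_neg (by linarith), if_pos h, modelSize, if_neg (by linarith), if_pos (by linarith)]
    have he : ENNReal.ofReal p ^ (-2 * α - 1) = ENNReal.ofReal ((p ^ 2) ^ (-β)) := by
      rw [hP, ENNReal.ofReal_rpow_of_pos hp]
      congr 2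
      rw [hβ, h]; ring
    rw [he]
    by_cases hxy : x = y
    · rw [if_pos hxy, hq0.mpr hxy, zero_div, zero_pow two_ne_zero, if_pos rfl]
      exact hEq rfl
    · have hq1 : 0 < q := lt_of_le_of_ne hq fun h => hxy (hq0.mp h.symm)
      rw [if_neg hxy, if_neg (by positivity)]
      have hL : 0 ≤ Real.log (p / q) := Real.log_nonneg (by rw [le_div_iff₀ hq1]; linarith)
      have e1 : 1 - Real.log ((q / p) ^ 2) = 1 + 2 * Real.log (p / q) := by
        rw [Real.log_pow, ← inv_div, Real.log_inv]; push_cast; ring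
      have e2 : Real.log (2 * p / q) = Real.log 2 + Real.log (p / q) := by
        rw [mul_div_assoc, Real.log_mul two_ne_zero (by positivity)]
      have l1 := Real.log_two_gt_d9
      have l2 := Real.log_two_lt_d9
      rw [e1, e2]
      constructor
      · rw [mul_left_comm, ← ENNReal.ofReal_mul (by norm_num)]
        exact mul_le_mul_right (ENNReal.ofReal_le_ofReal (by linarith)) _
      · exact mul_le_mul_right (ENNReal.ofReal_le_ofReal (by linarith)) _
  · rw [if_neg (by linarith), if_neg h.ne', modelSize, if_neg (by linarith), if_neg (by linarith),
      mul_one]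
    refine hEq ?_
    rw [ENNReal.ofReal_rpow_of_pos hp, ENNReal.ofReal_rpow_of_pos hp,
      ← ENNReal.ofReal_mul (by positivity), ← Real.rpow_add hp, hP]
    congr 2
    rw [hβ]; ring

/-- At the origin the integrand is identically infinite, and the Poisson measure is nonzero because
its zeroth moment is positive. -/
theorem rieszKernel_zero {α σ : ℝ} (hα : -1 / 2 ≤ α) (hσ : 0 < σ) (hσα : σ < α + 1) :
    rieszKernel α σ 0 0 = ∞ := by
  obtain ⟨ν, hν⟩ := exists_isPoissonMeasure hα
  have hG := Real.Gamma_pos_of_pos hσ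
  have hG' := Real.Gamma_pos_of_pos (show 0 < α + 1 - σ by linarith)
  have hG1 := Gamma_pos (α := α) (by linarith) 0
  have hν0 : ν univ ≠ 0 := fun h0 => by
    have h1 := hν.moment 0
    rw [Measure.measure_univ_eq_zero.mp h0, integral_zero_measure] at h1
    have : 0 < ((2 * 0).factorial : ℝ) /
      (2 * 4 ^ 0 * ((0 : ℕ).factorial * Real.Gamma ((0 : ℕ) + α + 1))) := by positivity
    exact this.ne h1
  rw [rieszKernel_eq_lintegral hν (by linarith) hσ hσα]
  have e : ∫⁻ s, (ENNReal.ofReal (1 + s) *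
          ENNReal.ofReal (0 ^ 2 + 0 ^ 2 - 2 * 0 * 0 * s) ^ (-(α + 1 - σ)) +
        ENNReal.ofReal (1 - s) *
          ENNReal.ofReal (0 ^ 2 + 0 ^ 2 + 2 * 0 * 0 * s) ^ (-(α + 1 - σ))) ∂ν =
      ∫⁻ _, ∞ ∂ν := by
    refine lintegral_congr_ae (hν.ae_mem.mono fun s hs => ?_)
    have : 0 < 1 + s := by linarith [hs.1]
    simp only [mul_zero, zero_mul, ne_eq, OfNat.ofNat_ne_zero, not_false_eq_true, zero_pow,
      add_zero, sub_zero, ENNReal.ofReal_zero]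
    rw [ENNReal.zero_rpow_of_neg (by linarith), ENNReal.mul_top
      (by rw [ne_eq, ENNReal.ofReal_eq_zero, not_le]; exact this), top_add]
  rw [e, lintegral_const, ENNReal.top_mul hν0, ENNReal.mul_top]
  rw [ne_eq, ENNReal.ofReal_eq_zero, not_le]
  positivity

theorem rieszKernel_comparableOn_of_lt {α σ : ℝ} (hα : -1 / 2 < α) (hσ : 0 < σ)
    (hσα : σ < α + 1) :
    ComparableOn (fun q : ℝ × ℝ => rieszKernel α σ q.1 q.2)
      (fun q => sharpBound α σ q.1 q.2) {q | 0 < |q.1| + |q.2|} := by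
  have hG := Real.Gamma_pos_of_pos hσ
  have hβ : 0 < α + 1 - σ := by linarith
  have hG' := Real.Gamma_pos_of_pos hβ
  have h1 : ComparableOn (fun q : ℝ × ℝ => rieszKernel α σ q.1 q.2)
      (rieszIntegral α (α + 1 - σ)) {q | 0 < |q.1| + |q.2|} :=
    (ComparableOn.of_eq fun q _ => rieszKernel_eq_lintegral (isPoissonMeasure_poissonMeasure hα)
      (by linarith) hσ hσα q.1 q.2).trans (ComparableOn.const_mul (by positivity) _ _)
  refine h1.trans (ComparableOn.trans ?_ (sharpBound_comparableOn rfl).symm)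
  have hpos := rieszIntegral_comparableOn_of_mul_nonneg hα hβ
  have hmaps : MapsTo (fun q : ℝ × ℝ => (|q.1 - q.2| / (|q.1| + |q.2|)) ^ 2)
      {q : ℝ × ℝ | 0 < |q.1| + |q.2| ∧ 0 ≤ q.1 * q.2} (Icc 0 1) := fun q hq =>
    ⟨by positivity, pow_le_one₀ (by positivity) ((div_le_one hq.1).mpr (abs_sub q.1 q.2))⟩
  have hmodel := ((comparableOn_modelIntegral (γ := α - 1 / 2) (κ := σ - 1 / 2) hβ (by linarith)
    (by ring)).comp _ hmaps).mul_left
      (fun q => ENNReal.ofReal (((|q.1| + |q.2|) ^ 2) ^ (-(α + 1 - σ))))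
  have hneg := rieszIntegral_comparableOn_of_mul_neg hα hβ (by linarith)
  -- For xy < 0 the ratio |x-y|/(|x|+|y|) is 1, where the model size is 1, so both signs share one
  -- comparison function.
  have hneg' : ComparableOn (rieszIntegral α (α + 1 - σ))
      (fun q => ENNReal.ofReal (((|q.1| + |q.2|) ^ 2) ^ (-(α + 1 - σ))) *
        modelSize (σ - 1 / 2) ((|q.1 - q.2| / (|q.1| + |q.2|)) ^ 2)) {q | q.1 * q.2 < 0} := by
    refine hneg.trans (ComparableOn.of_eq fun q hq => ?_)
    have hq' : q.1 * q.2 < 0 := hq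
    have hq1 : 0 < |q.1| := abs_pos.mpr fun h => by simp [h] at hq'
    have hq2 : 0 < |q.1| + |q.2| := by positivity
    have : |q.1 - q.2| = |q.1| + |q.2| := by
      rw [← abs_of_pos hq2, ← sq_eq_sq_iff_abs_eq_abs, add_sq, sq_abs, sq_abs, mul_assoc, ← abs_mul,
        abs_of_neg hq']
      ring
    rw [this, div_self hq2.ne', one_pow, modelSize_one, mul_one]
  have hunion := (hpos.trans hmodel).union hneg'
  obtain ⟨c, C, hc, hC, H⟩ := hunion
  refine ⟨c, C, hc, hC, fun q hq => H q ?_⟩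
  rcases le_or_gt 0 (q.1 * q.2) with h | h
  · exact Or.inl ⟨hq, h⟩
  · exact Or.inr h

/-- At the atom s = 1 the weight 1-s vanishes, so only a multiple of ((x-y)²)^{-β} remains, with -2β
= 2σ-1. The hypothesis forces σ < 1/2, so the other two cases do not occur. -/
theorem rieszKernel_comparableOn_neg_half {σ : ℝ} (hσ : 0 < σ) (hσα : σ < -1 / 2 + 1) :
    ComparableOn (fun q : ℝ × ℝ => rieszKernel (-1 / 2) σ q.1 q.2)
      (fun q => sharpBound (-1 / 2) σ q.1 q.2) {q | 0 < |q.1| + |q.2|} := by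
  have hG := Real.Gamma_pos_of_pos hσ
  have hβ : 0 < -1 / 2 + 1 - σ := by linarith
  have hG' := Real.Gamma_pos_of_pos hβ
  have h4 : 0 < √Real.pi := Real.sqrt_pos.mpr Real.pi_pos
  refine (ComparableOn.of_eq fun q _ => rieszKernel_eq_lintegral isPoissonMeasure_dirac
      (by norm_num) hσ hσα q.1 q.2).trans ((ComparableOn.const_mul (by positivity) _ _).trans ?_)
  simp only [lintegral_smul_measure, lintegral_dirac, smul_eq_mul]
  refine (ComparableOn.const_mul (by positivity) _ _).trans ?_
  simp only [sub_self, ENNReal.ofReal_zero, zero_mul, add_zero]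
  refine (ComparableOn.const_mul (by norm_num) _ _).trans (ComparableOn.of_eq fun q hq => ?_)
  have hq' : 0 < |q.1| + |q.2| := hq
  have hne : ¬(q.1 = 0 ∧ q.2 = 0) := by
    rintro ⟨h1, h2⟩; simp [h1, h2] at hq'
  rw [sharpBound, if_neg hne, if_pos (by linarith)]
  rw [show -2 * (-1 / 2 : ℝ) - 1 = 0 by norm_num, ENNReal.rpow_zero, one_mul,
    show q.1 ^ 2 + q.2 ^ 2 - 2 * q.1 * q.2 * 1 = |q.1 - q.2| ^ 2 by rw [sq_abs]; ring,
    ENNReal.ofReal_pow (abs_nonneg _), ← ENNReal.rpow_natCast, ← ENNReal.rpow_mul]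
  congr 1
  push_cast
  ring

end HankelDunkl

end

theorem theorem2p15 (α σ : ℝ) (hα : -1 / 2 ≤ α) (hσ : 0 < σ) (hσα : σ < α + 1) :
    (∀ t x y : ℝ, 0 < t →
      (HankelDunkl.heatKernel α t x y).im = 0 ∧ 0 ≤ (HankelDunkl.heatKernel α t x y).re) ∧
    ∃ C : ℝ, 0 < C ∧ ∀ x y : ℝ,
      ENNReal.ofReal C⁻¹ * HankelDunkl.sharpBound α σ x y ≤ HankelDunkl.rieszKernel α σ x y ∧
      HankelDunkl.rieszKernel α σ x y ≤ ENNReal.ofReal C * HankelDunkl.sharpBound α σ x y := by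
  constructor
  · intro t x y ht
    obtain ⟨ν, hν⟩ := HankelDunkl.exists_isPoissonMeasure hα
    exact ⟨HankelDunkl.heatKernel_im_eq_zero hν (by linarith) ht x y,
      HankelDunkl.heatKernel_re_nonneg hν (by linarith) ht x y⟩
  · have hcomp : HankelDunkl.ComparableOn (fun q : ℝ × ℝ => HankelDunkl.rieszKernel α σ q.1 q.2)
        (fun q => HankelDunkl.sharpBound α σ q.1 q.2) {q | 0 < |q.1| + |q.2|} := by
      rcases hα.eq_or_lt with rfl | h
      · exact HankelDunkl.rieszKernel_comparableOn_neg_half hσ hσα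
      · exact HankelDunkl.rieszKernel_comparableOn_of_lt h hσ hσα
    obtain ⟨c, C, hc, hC, H⟩ := hcomp
    -- One constant serves both sides: it is at least `C`, and its inverse is at most `c`.
    refine ⟨max C c⁻¹, by positivity, fun x y => ?_⟩
    by_cases hxy : x = 0 ∧ y = 0
    · obtain ⟨rfl, rfl⟩ := hxy
      rw [HankelDunkl.rieszKernel_zero hα hσ hσα]
      refine ⟨le_top, ?_⟩
      rw [HankelDunkl.sharpBound, if_pos ⟨rfl, rfl⟩, ENNReal.mul_top]
      rw [ne_eq, ENNReal.ofReal_eq_zero, not_le]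
      positivity
    · have hp : 0 < |x| + |y| := by
        rcases not_and_or.mp hxy with h | h
        · have := abs_pos.mpr h; positivity
        · have := abs_pos.mpr h; positivity
      obtain ⟨h1, h2⟩ := H (x, y) hp
      constructor
      · refine le_trans (mul_le_mul_left (ENNReal.ofReal_le_ofReal ?_) _) h1
        exact inv_le_of_inv_le₀ hc (le_max_right _ _)
      · exact h2.trans (mul_le_mul_left (ENNReal.ofReal_le_ofReal (le_max_left _ _)) _)
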